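/- Let $E_8^7$ be the lattice of all $(m_1,m_2)$ such that either $m_1,m_2\in\mathbb Z$ and $m_1+m_2$ is even, or $m_1,m_2\in\mathbb Z+\frac12$ and $m_1+m_2$ is odd, with norm $(m_1,m_2)^2=m_1^2+7m_2^2$. Let $II_{1,1}$ be $\mathbb Z^2$ with norm $(m,n)^2=-2mn$, and let $L=E_8^7(-2)\oplus II_{1,1}$, with elements $(r,m,n)$, $r\in E_8^7$, $m,n\in\mathbb Z$, and norm $(r,m,n)^2=-2r^2-2mn$. A root of $L$ is a primitive vector $\alpha\in L$ of negative norm such that the reflection in $\alpha^\perp$ maps $L$ to itself. $Aut(L)^+$ is the group of automorphisms of $L$ that map each of the two cones of positive norm vectors in $L\otimes\mathbb R$ to itself, and $W\subseteq Aut(L)^+$, the reflection group of $L$, is the group generated by the reflections in the roots. The hyperplanes $\alpha^\perp$ of the roots divide the positive norm vectors into Weyl chambers. The simple roots of a Weyl chamber $D$ are the roots that are nonnegative on $D$ and whose hyperplanes contain a face of codimension one of $D$. A Weyl vector of $D$ is a vector $\rho$ such that the simple roots of $D$ are exactly the roots $\alpha$ with $(\rho,\alpha)=\alpha^2/2$.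 $W$ is called arithmetic if for every Weyl chamber $D$ the group of elements of $Aut(L)^+$ mapping $D$ to itself is finite. Then $L$ is an even Lorentzian lattice (signature $(1,3)$) of level $14$, and the norms of its roots are exactly $-2$, $-4$, $-14$ and $-28$. Every Weyl chamber $D$ has exactly 8 simple roots, two of each of these norms, and has a Weyl vector $\rho\in L$ of norm $\rho^2=4$. The vector $\rho=(r,-2,3)$ with $r=(2,0)$ is the Weyl vector of one of the Weyl chambers. The Dynkin diagram of the simple roots of $D$ is as follows. The nodes are $A,B,C,D',E,F,G,H$. Put $t(\alpha,\beta)=4(\alpha,\beta)^2/(\alpha^2\beta^2)$. Distinct simple roots satisfy $(\alpha,\beta)\ge 0$. The pairs $AB$, $CD'$ are joined by double lines ($t=2$, angle $\pi/4$); the pairs $AC$, $BD'$, $EG$, $FH$ by lines marked $\infty$ ($t=4$, parallel hyperplanes); the pairs $AE$, $BF$, $CG$, $D'H$, $EF$, $GH$, $EH$, $FG$ by dashed lines ($t>4$, ultraparallel hyperplanes); all other pairs are not joined ($t=0$, orthogonal roots). The reflection group $W$ of $L$ is arithmetic and has index $2$ in $Aut(L)^+$. -/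

import Mathlib

/-! ### Lorentzian lattices, their roots and their reflection groups

`V` is the real vector space `L ⊗ ℝ`, `B` the bilinear form on it, and the lattice `L` is a
`ℤ`-submodule of `V`.  The norm of `x` is `B x x`, and Lorentzian means signature `(1, n - 1)`. -/

section LorentzianLattices

variable {V : Type*} [AddCommGroup V] [Module ℝ V]

/-- `L` is an even Lorentzian lattice in `V = L ⊗ ℝ`. -/
structure IsEvenLorentzianLattice (B : LinearMap.BilinForm ℝ V) (L : Submodule ℤ V) : Prop where
  symm : ∀ x y, B x y = B y x
  signature : ∃ w, 0 < B w w ∧ ∀ x, B w x = 0 → x ≠ 0 → B x x < 0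
  lattice : ∃ (n : ℕ) (b : Module.Basis (Fin n) ℝ V), L = Submodule.span ℤ (Set.range b)
  integral : ∀ x ∈ L, ∀ y ∈ L, ∃ k : ℤ, B x y = k
  even : ∀ x ∈ L, ∃ k : ℤ, B x x = 2 * k

/-- The level of `L` is `N`: the least positive integer `N` such that `N x² / 2` is an integer for
all `x` in the dual lattice `L'`. -/
def HasLevel (B : LinearMap.BilinForm ℝ V) (L : Submodule ℤ V) (N : ℕ) : Prop :=
  IsLeast {N : ℕ | 0 < N ∧ ∀ x ∈ B.dualSubmodule L, ∃ k : ℤ, (N : ℝ) * (B x x / 2) = k} N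

/-- A root of `L`: a primitive vector of negative norm in `L` such that the reflection in its
orthogonal hyperplane maps `L` to itself. -/
structure IsRoot (B : LinearMap.BilinForm ℝ V) (L : Submodule ℤ V) (α : V) : Prop where
  mem : α ∈ L
  primitive : ∀ β ∈ L, ∀ k : ℤ, α = k • β → k = 1 ∨ k = -1
  neg : B α α < 0
  reflection_mem : ∀ x ∈ L, x - (2 * B x α / B α α) • α ∈ L

/-- The cone of positive norm vectors that contains the positive norm vector `x`. -/
def posCone (B : LinearMap.BilinForm ℝ V) (x : V) : Set V :=
  {y | 0 < B y y ∧ 0 < B x y}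

/-- `Aut(L)⁺`: the isometries of `L` (extended to `V = L ⊗ ℝ`) that map each of the two cones of
positive norm vectors to itself. -/
def autPlus (B : LinearMap.BilinForm ℝ V) (L : Submodule ℤ V) : Subgroup (V ≃ₗ[ℝ] V) where
  carrier := {g | (∀ x y, B (g x) (g y) = B x y) ∧ (∀ x, g x ∈ L ↔ x ∈ L) ∧
    ∀ x, 0 < B x x → g '' posCone B x = posCone B x}
  one_mem' := by simp
  mul_mem' := by
    rintro g h ⟨g1, g2, g3⟩ ⟨h1, h2, h3⟩
    refine ⟨fun x y => ?_, fun x => ?_, fun x hx => ?_⟩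
    · simp [g1, h1]
    · simp [g2, h2]
    · have : (⇑(g * h) : V → V) = g ∘ h := rfl
      rw [this, Set.image_comp, h3 x hx, g3 x hx]
  inv_mem' := by
    rintro g ⟨g1, g2, g3⟩
    have e : ∀ x, g (g⁻¹ x) = x := fun x => g.apply_symm_apply x
    have e' : ∀ x, g⁻¹ (g x) = x := fun x => g.symm_apply_apply x
    refine ⟨fun x y => ?_, fun x => ?_, fun x hx => ?_⟩
    · rw [← g1, e, e]
    · rw [← g2, e]
    · conv_lhs => rw [← g3 x hx]
      rw [← Set.image_comp]
      have : (⇑g⁻¹ ∘ ⇑g : V → V) = id := funext e'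
      rw [this, Set.image_id]

/-- The reflection group `W` of `L`: the group generated by the reflections in the roots of `L`. -/
def reflectionGroup (B : LinearMap.BilinForm ℝ V) (L : Submodule ℤ V) : Subgroup (V ≃ₗ[ℝ] V) :=
  Subgroup.closure {g | ∃ α, IsRoot B L α ∧ ∀ x, g x = x - (2 * B x α / B α α) • α}

/-- The (closed) Weyl chamber of the point `x`: the vectors of the positive norm cone of `x` that
are not separated from `x` by the hyperplane of any root. -/
def weylChamber (B : LinearMap.BilinForm ℝ V) (L : Submodule ℤ V) (x : V) : Set V :=
  {y | y ∈ posCone B x ∧ ∀ α, IsRoot B L α → 0 < B x α → 0 ≤ B y α}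

/-- `D` is a Weyl chamber of the reflection group, that is the chamber of a positive norm vector
that lies on no root hyperplane.  It is written as a cone in `V`; intersecting with the vectors of
norm `1` gives the chamber in hyperbolic space. -/
def IsWeylChamber (B : LinearMap.BilinForm ℝ V) (L : Submodule ℤ V) (D : Set V) : Prop :=
  ∃ x, 0 < B x x ∧ (∀ α, IsRoot B L α → B x α ≠ 0) ∧ D = weylChamber B L x

/-- The simple roots of the Weyl chamber `D`: the roots `α` that are nonnegative on `D` and whose
hyperplane meets `D` in a face of codimension one (a subset spanning the hyperplane). -/
def simpleRoots (B : LinearMap.BilinForm ℝ V) (L : Submodule ℤ V) (D : Set V) : Set V :=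
  {α | IsRoot B L α ∧ (∀ y ∈ D, 0 ≤ B y α) ∧
    ∀ y, B y α = 0 → y ∈ Submodule.span ℝ {z | z ∈ D ∧ B z α = 0}}

/-- `ρ` is a Weyl vector for `D`: the simple roots of `D` are exactly the roots `α` of `L` with
`(ρ, α) = α² / 2`. -/
def IsWeylVector (B : LinearMap.BilinForm ℝ V) (L : Submodule ℤ V) (D : Set V) (ρ : V) : Prop :=
  ∀ α, IsRoot B L α → (α ∈ simpleRoots B L D ↔ B ρ α = B α α / 2)

/-- `Aut(D)`: the elements of `Aut(L)⁺` that map the chamber `D` to itself. -/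
def autChamber (B : LinearMap.BilinForm ℝ V) (L : Submodule ℤ V) (D : Set V) :
    Set (V ≃ₗ[ℝ] V) :=
  {g | g ∈ autPlus B L ∧ g '' D = D}

/-- The reflection group of `L` is arithmetic: `Aut(D)` is finite for the Weyl chambers `D`. -/
def IsArithmeticReflectionGroup (B : LinearMap.BilinForm ℝ V) (L : Submodule ℤ V) : Prop :=
  ∀ D, IsWeylChamber B L D → (autChamber B L D).Finite

/-- The possible joins of two distinct nodes of a Dynkin diagram: `none`, `single`, `double`,
`triple` for hyperplanes meeting at the angle `π/2`, `π/3`, `π/4`, `π/6`, `infinite` (a line marked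
`∞`) for parallel hyperplanes, and `dashed` for ultraparallel (divergent) hyperplanes. -/
inductive Bond
  | none | single | double | triple | infinite | dashed

/-- The faces of the simple roots `α`, `β` are in the position described by the bond: the cosine
`c = (α, β) / √(α² β²)` of the dihedral angle satisfies `c ≥ 0` and
`4 c² = 0, 1, 2, 3, 4` or `> 4`. -/
def IsBond (B : LinearMap.BilinForm ℝ V) (α β : V) (b : Bond) : Prop :=
  0 ≤ B α β ∧
    match b with
    | .none => 4 * B α β ^ 2 / (B α α * B β β) = 0
    | .single => 4 * B α β ^ 2 / (B α α * B β β) = 1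
    | .double => 4 * B α β ^ 2 / (B α α * B β β) = 2
    | .triple => 4 * B α β ^ 2 / (B α α * B β β) = 3
    | .infinite => 4 * B α β ^ 2 / (B α α * B β β) = 4
    | .dashed => 4 < 4 * B α β ^ 2 / (B α α * B β β)

/-- The set `S` of simple roots has the Dynkin diagram `Γ` with set of nodes `ι`. -/
def HasDynkinDiagram {ι : Type*} (B : LinearMap.BilinForm ℝ V) (S : Set V) (Γ : ι → ι → Bond) :
    Prop :=
  ∃ v : ι → V, Function.Injective v ∧ Set.range v = S ∧ ∀ i j, i ≠ j → IsBond B (v i) (v j) (Γ i j)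

end LorentzianLattices

/-! ### The lattice `E₈⁷(-2) ⊕ II₁,₁` -/

/-- The form of `E₈⁷`, with norm `(m₁, m₂)² = m₁² + 7 m₂²`. -/
noncomputable def e87Form : LinearMap.BilinForm ℝ (ℝ × ℝ) :=
  LinearMap.mk₂ ℝ (fun x y => x.1 * y.1 + 7 * (x.2 * y.2))
    (by intros; simp; ring) (by intros; simp; ring) (by intros; simp; ring) (by intros; simp; ring)

/-- The lattice `E₈⁷`: the `(m₁, m₂)` with `m₁, m₂` in `ℤ` and `m₁ + m₂` even, or with `m₁, m₂` in
`ℤ + 1/2` and `m₁ + m₂` odd. -/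
noncomputable def e87 : Submodule ℤ (ℝ × ℝ) :=
  AddSubgroup.toIntSubmodule
    { carrier := {x | (∃ a b : ℤ, x = ((a : ℝ), (b : ℝ)) ∧ Even (a + b)) ∨
        (∃ a b : ℤ, x = ((a : ℝ) + 1 / 2, (b : ℝ) + 1 / 2) ∧ Odd (a + b + 1))}
      zero_mem' := Or.inl ⟨0, 0, by ext <;> simp, by simp⟩
      add_mem' := by
        rintro x y (⟨a, b, rfl, h⟩ | ⟨a, b, rfl, h⟩) (⟨c, d, rfl, k⟩ | ⟨c, d, rfl, k⟩)
        · exact Or.inl ⟨a + c, b + d, by ext <;> simp, by grind⟩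
        · exact Or.inr ⟨a + c, b + d, by ext <;> simp <;> ring, by grind⟩
        · exact Or.inr ⟨a + c, b + d, by ext <;> simp <;> ring, by grind⟩
        · exact Or.inl ⟨a + c + 1, b + d + 1, by ext <;> simp <;> ring, by grind⟩
      neg_mem' := by
        rintro x (⟨a, b, rfl, h⟩ | ⟨a, b, rfl, h⟩)
        · exact Or.inl ⟨-a, -b, by ext <;> simp, by grind⟩
        · exact Or.inr ⟨-a - 1, -b - 1, by ext <;> simp <;> ring, by grind⟩ }

/-- The form of `II₁,₁`, with norm `(m, n)² = -2mn`. -/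
noncomputable def hyperbolicForm : LinearMap.BilinForm ℝ (ℝ × ℝ) :=
  LinearMap.mk₂ ℝ (fun x y => -(x.1 * y.2 + x.2 * y.1))
    (by intros; simp; ring) (by intros; simp; ring) (by intros; simp; ring) (by intros; simp; ring)

/-- The lattice `II₁,₁ = ℤ²`. -/
noncomputable def hyperbolicPlane : Submodule ℤ (ℝ × ℝ) :=
  Submodule.span ℤ {((1 : ℝ), (0 : ℝ)), ((0 : ℝ), (1 : ℝ))}

/-- The form of `E₈⁷(-2) ⊕ II₁,₁`: the orthogonal sum of the form of `E₈⁷` multiplied by `-2` and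
the form of `II₁,₁`. -/
noncomputable def lorentzForm : LinearMap.BilinForm ℝ ((ℝ × ℝ) × (ℝ × ℝ)) :=
  ((-2 : ℝ) • e87Form).compl₁₂ (LinearMap.fst ℝ _ _) (LinearMap.fst ℝ _ _) +
    hyperbolicForm.compl₁₂ (LinearMap.snd ℝ _ _) (LinearMap.snd ℝ _ _)

/-- The lattice `E₈⁷(-2) ⊕ II₁,₁`; its elements are written `(r, m, n)`. -/
noncomputable def lorentzLattice : Submodule ℤ ((ℝ × ℝ) × (ℝ × ℝ)) :=
  e87.prod hyperbolicPlane

/-- The Dynkin diagram.  The nodes are placed as follows, `0, 1, 2, 3` being the corners of the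
outer square and `4, 5, 6, 7` those of the inner one:
```
  0           1
     4     5
     6     7
  2           3
``` -/
def dynkinDiagram (i j : Fin 8) : Bond :=
  if s(i, j) ∈ [s(0, 1), s(2, 3)] then .double
  else if s(i, j) ∈ [s(0, 2), s(1, 3), s(4, 6), s(5, 7)] then .infinite
  else if s(i, j) ∈ [s(0, 4), s(1, 5), s(2, 6), s(3, 7), s(4, 5), s(6, 7), s(4, 7), s(5, 6)] then
    .dashed
  else .none

/-! ### Coordinates on `E₈⁷(-2) ⊕ II₁,₁` -/

/-! The proof is Vinberg-style, centred on the negative `basePoint` of the Weyl vector. Call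
(`basePoint`, α) the height of a root α.

Integrality of its reflection forces a root of norm -2k to satisfy k ∣ (α, x) for all x in the
lattice. Hence α / k lies in the dual lattice, and as 14 kills the discriminant group, primitivity
gives k ∣ 14. The form is negative definite on the complement of `basePoint`, so finite searches
show that no root has height 0 and that exactly eight roots of norm -2k have height k: these are the
`simpleVec i`.

The Gram matrix of the eight vectors yields the identity `lorentzForm_eq_sum_mul`, which writes 28
(x, y) as a sum of products (x, αᵢ)(y, αⱼ) with coefficients 1. So a vector with nonnegative
products with all αᵢ has nonnegative norm, and every root has a negative product with some αᵢ.
Reflecting in that αᵢ lowers the height, and by a Cauchy–Schwarz estimate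
(`IsRoot.height_simpleReflection_pos`) the height stays positive unless the root is αᵢ itself.
Descent on the height shows that positive roots are nonnegative combinations of the αᵢ, so the αᵢ
cut out a Weyl chamber. All eight are needed, as each face has an explicit interior point.

Any generic vector in the cone of `basePoint` is moved into this chamber by `W`: minimise its
product over the orbit of `basePoint`. Up to sign, all chambers are therefore equivalent. An
isometry fixing the chamber permutes the αᵢ and preserves their Gram matrix, which leaves only the
identity and `chamberSymmetry`. The latter is not in `W`, because `W` preserves `parityClass` and it
does not. This gives both arithmeticity and index 2. -/

/-- The real quadratic space spanned by the lattice. -/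
abbrev LSpace : Type := (ℝ × ℝ) × (ℝ × ℝ)

theorem lorentzForm_apply (x y : LSpace) :
    lorentzForm x y = -2 * (x.1.1 * y.1.1 + 7 * (x.1.2 * y.1.2)) -
      (x.2.1 * y.2.2 + x.2.2 * y.2.1) := by
  simp [lorentzForm, e87Form, hyperbolicForm]
  ring

theorem lorentzForm_comm (x y : LSpace) : lorentzForm x y = lorentzForm y x := by
  simp only [lorentzForm_apply]; ring

/-- The lattice vector with integral coordinates `a, b, m, n`, where `a, b` refer to the basis
`(1/2, 1/2), (2, 0)` of `E₈⁷`. -/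
noncomputable def latVec (a b m n : ℤ) : LSpace :=
  (((a : ℝ) / 2 + 2 * b, (a : ℝ) / 2), ((m : ℝ), (n : ℝ)))

theorem mem_hyperbolicPlane (x : ℝ × ℝ) :
    x ∈ hyperbolicPlane ↔ ∃ m n : ℤ, x = ((m : ℝ), (n : ℝ)) := by
  rw [hyperbolicPlane, Submodule.mem_span_pair]
  constructor
  · rintro ⟨m, n, rfl⟩
    exact ⟨m, n, by ext <;> simp⟩
  · rintro ⟨m, n, rfl⟩
    exact ⟨m, n, by ext <;> simp⟩

theorem mem_e87 (x : ℝ × ℝ) :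
    x ∈ e87 ↔ ∃ a b : ℤ, x = ((a : ℝ) / 2 + 2 * b, (a : ℝ) / 2) := by
  have h : x ∈ e87 ↔ (∃ a b : ℤ, x = ((a : ℝ), (b : ℝ)) ∧ Even (a + b)) ∨
      (∃ a b : ℤ, x = ((a : ℝ) + 1 / 2, (b : ℝ) + 1 / 2) ∧ Odd (a + b + 1)) := Iff.rfl
  rw [h]
  constructor
  · rintro (⟨a, b, rfl, c, hc⟩ | ⟨a, b, rfl, c, hc⟩)
    · refine ⟨2 * b, c - b, ?_⟩
      have : (a : ℝ) + b = c + c := by exact_mod_cast hc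
      ext <;> push_cast <;> linarith
    · refine ⟨2 * b + 1, c - b, ?_⟩
      have : (a : ℝ) + b + 1 = 2 * c + 1 := by exact_mod_cast hc
      ext <;> push_cast <;> linarith
  · rintro ⟨a, b, rfl⟩
    rcases Int.even_or_odd' a with ⟨c, rfl | rfl⟩
    · refine Or.inl ⟨c + 2 * b, c, ?_, c + b, by ring⟩
      ext <;> push_cast <;> ring
    · refine Or.inr ⟨c + 2 * b, c, ?_, c + b, by ring⟩
      ext <;> push_cast <;> ring

theorem mem_lorentzLattice (x : LSpace) :
    x ∈ lorentzLattice ↔ ∃ a b m n : ℤ, x = latVec a b m n := by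
  rw [lorentzLattice, Submodule.mem_prod, mem_e87, mem_hyperbolicPlane]
  constructor
  · rintro ⟨⟨a, b, h⟩, m, n, h'⟩
    exact ⟨a, b, m, n, Prod.ext h h'⟩
  · rintro ⟨a, b, m, n, rfl⟩
    exact ⟨⟨a, b, rfl⟩, m, n, rfl⟩

theorem latVec_mem (a b m n : ℤ) : latVec a b m n ∈ lorentzLattice :=
  (mem_lorentzLattice _).2 ⟨a, b, m, n, rfl⟩

theorem latVec_inj {a b m n a' b' m' n' : ℤ} :
    latVec a b m n = latVec a' b' m' n' ↔ a = a' ∧ b = b' ∧ m = m' ∧ n = n' := by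
  constructor
  · intro h
    simp only [latVec, Prod.mk.injEq, Int.cast_inj] at h
    obtain ⟨⟨h1, h2⟩, h3, h4⟩ := h
    have ha : (a : ℝ) = a' := by linarith
    have hb : (b : ℝ) = b' := by linarith
    exact ⟨by exact_mod_cast ha, by exact_mod_cast hb, h3, h4⟩
  · rintro ⟨rfl, rfl, rfl, rfl⟩; rfl

theorem latVec_add (a b m n a' b' m' n' : ℤ) :
    latVec a b m n + latVec a' b' m' n' = latVec (a + a') (b + b') (m + m') (n + n') := by
  ext <;> simp [latVec] <;> ring

theorem latVec_smul (k a b m n : ℤ) :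
    (k : ℝ) • latVec a b m n = latVec (k * a) (k * b) (k * m) (k * n) := by
  ext <;> simp [latVec] <;> ring

theorem lorentzForm_latVec (a b m n a' b' m' n' : ℤ) :
    lorentzForm (latVec a b m n) (latVec a' b' m' n') =
      ((-2 * (2 * a * a' + a * b' + b * a' + 4 * b * b') - (m * n' + n * m') : ℤ) : ℝ) := by
  simp only [lorentzForm_apply, latVec]; push_cast; ring

theorem lorentzForm_latVec_self (a b m n : ℤ) :
    lorentzForm (latVec a b m n) (latVec a b m n) =
      ((-4 * (a ^ 2 + a * b + 2 * b ^ 2) - 2 * m * n : ℤ) : ℝ) := by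
  rw [lorentzForm_latVec]; congr 1; ring

/-- The coordinates with respect to the lattice basis. -/
noncomputable def latCoord : LSpace ≃ₗ[ℝ] (Fin 4 → ℝ) where
  toFun x := ![2 * x.1.2, (x.1.1 - x.1.2) / 2, x.2.1, x.2.2]
  invFun f := ((f 0 / 2 + 2 * f 1, f 0 / 2), (f 2, f 3))
  map_add' x y := by ext i; fin_cases i <;> simp <;> ring
  map_smul' c x := by ext i; fin_cases i <;> simp <;> ring
  left_inv x := by ext <;> simp; ring
  right_inv f := by ext i; fin_cases i <;> simp; ring

theorem lorentzLattice_eq_span :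
    lorentzLattice = Submodule.span ℤ (Set.range (Module.Basis.ofEquivFun latCoord)) := by
  ext x
  rw [mem_lorentzLattice, Submodule.mem_span_range_iff_exists_fun]
  have key : ∀ c : Fin 4 → ℤ, ∑ i, c i • (Module.Basis.ofEquivFun latCoord) i =
      latVec (c 0) (c 1) (c 2) (c 3) := by
    intro c
    apply latCoord.injective
    rw [map_sum]
    ext j
    simp only [map_zsmul, Finset.sum_apply, Pi.smul_apply, Module.Basis.coe_ofEquivFun,
      LinearEquiv.apply_symm_apply, Fin.sum_univ_four]
    fin_cases j <;> simp [latCoord, latVec]; ring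
  constructor
  · rintro ⟨a, b, m, n, rfl⟩
    exact ⟨![a, b, m, n], by rw [key]; simp⟩
  · rintro ⟨c, rfl⟩
    exact ⟨_, _, _, _, key c⟩

/-! ### Signature, evenness and level. -/

theorem isEvenLorentzianLattice_lorentzLattice :
    IsEvenLorentzianLattice lorentzForm lorentzLattice where
  symm := lorentzForm_comm
  signature := by
    refine ⟨((0, 0), (1, -1)), by simp [lorentzForm_apply], ?_⟩
    rintro ⟨⟨p, q⟩, m, n⟩ h hx
    simp only [lorentzForm_apply] at h ⊢
    have hmn : m = n := by linarith
    subst hmn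
    by_contra hneg
    have h1 : p = 0 := by nlinarith [sq_nonneg p, sq_nonneg q, sq_nonneg m]
    have h2 : q = 0 := by nlinarith [sq_nonneg p, sq_nonneg q, sq_nonneg m]
    have h3 : m = 0 := by nlinarith [sq_nonneg p, sq_nonneg q, sq_nonneg m]
    subst h1 h2 h3
    exact hx rfl
  lattice := ⟨4, _, lorentzLattice_eq_span⟩
  integral := by
    intro x hx y hy
    obtain ⟨a, b, m, n, rfl⟩ := (mem_lorentzLattice x).1 hx
    obtain ⟨a', b', m', n', rfl⟩ := (mem_lorentzLattice y).1 hy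
    exact ⟨_, lorentzForm_latVec ..⟩
  even := by
    intro x hx
    obtain ⟨a, b, m, n, rfl⟩ := (mem_lorentzLattice x).1 hx
    refine ⟨-2 * (a ^ 2 + a * b + 2 * b ^ 2) - m * n, ?_⟩
    rw [lorentzForm_latVec_self]; push_cast; ring

theorem hasLevel_lorentzLattice : HasLevel lorentzForm lorentzLattice 14 := by
  have hdual : ∀ x : LSpace, x ∈ lorentzForm.dualSubmodule lorentzLattice ↔
      ∀ y ∈ lorentzLattice, ∃ k : ℤ, lorentzForm x y = k := by
    intro x
    rw [LinearMap.BilinForm.mem_dualSubmodule]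
    simp only [Submodule.mem_one, eq_intCast, eq_comm]
  constructor
  · refine ⟨by norm_num, fun x hx => ?_⟩
    rw [hdual] at hx
    obtain ⟨p, hp⟩ := hx _ (latVec_mem 1 0 0 0)
    obtain ⟨q, hq⟩ := hx _ (latVec_mem 0 1 0 0)
    obtain ⟨r, hr⟩ := hx _ (latVec_mem 0 0 1 0)
    obtain ⟨s, hs⟩ := hx _ (latVec_mem 0 0 0 1)
    simp only [lorentzForm_apply, latVec] at hp hq hr hs
    push_cast at hp hq hr hs
    refine ⟨-(2 * p ^ 2 - p * q + q ^ 2) - 14 * r * s, ?_⟩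
    rw [lorentzForm_apply]
    push_cast
    rw [← hp, ← hq, ← hr, ← hs]
    ring
  · rintro N ⟨hN, h⟩
    -- This is minus the dual basis vector of (2, 0). Its norm is -1/7, so integrality of N x² / 2 =
    -- -N / 14 forces 14 ∣ N.
    have hx : (((3 / 14 + 1 / 28 : ℝ), (-1 / 28 : ℝ)), ((0 : ℝ), (0 : ℝ))) ∈
        lorentzForm.dualSubmodule lorentzLattice := by
      rw [hdual]
      intro y hy
      obtain ⟨a, b, m, n, rfl⟩ := (mem_lorentzLattice y).1 hy
      refine ⟨-b, ?_⟩
      simp only [lorentzForm_apply, latVec]; push_cast; ring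
    obtain ⟨k, hk⟩ := h _ hx
    simp only [lorentzForm_apply] at hk
    have : (N : ℝ) = ((-14 * k : ℤ) : ℝ) := by push_cast; rw [← hk]; ring
    have : (N : ℤ) = -14 * k := by exact_mod_cast this
    omega

/-! ### Isometries of a lattice act on roots, chambers and simple roots -/

section Transport

variable {V : Type*} [AddCommGroup V] [Module ℝ V] {B : LinearMap.BilinForm ℝ V}
  {L : Submodule ℤ V}

/-- The isometry group of the lattice `L`. -/
def latticeIsometries (B : LinearMap.BilinForm ℝ V) (L : Submodule ℤ V) :
    Subgroup (V ≃ₗ[ℝ] V) where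
  carrier := {g | (∀ x y, B (g x) (g y) = B x y) ∧ ∀ x, g x ∈ L ↔ x ∈ L}
  one_mem' := by simp
  mul_mem' := by
    rintro g h ⟨g1, g2⟩ ⟨h1, h2⟩
    exact ⟨fun x y => by simp [g1, h1], fun x => by simp [g2, h2]⟩
  inv_mem' := by
    rintro g ⟨g1, g2⟩
    have e : ∀ x, g (g⁻¹ x) = x := fun x => g.apply_symm_apply x
    exact ⟨fun x y => by rw [← g1, e, e], fun x => by rw [← g2, e]⟩

theorem LinearEquiv.apply_inv_apply (g : V ≃ₗ[ℝ] V) (x : V) : g (g⁻¹ x) = x :=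
  g.apply_symm_apply x

theorem LinearEquiv.inv_apply_apply (g : V ≃ₗ[ℝ] V) (x : V) : g⁻¹ (g x) = x :=
  g.symm_apply_apply x

theorem autPlus_le_latticeIsometries : autPlus B L ≤ latticeIsometries B L :=
  fun _ hg => ⟨hg.1, hg.2.1⟩

variable {g : V ≃ₗ[ℝ] V}

theorem IsRoot.map (hg : g ∈ latticeIsometries B L) {α : V} (h : IsRoot B L α) :
    IsRoot B L (g α) where
  mem := (hg.2 α).2 h.mem
  primitive β hβ k hk := by
    refine h.primitive (g⁻¹ β) (((latticeIsometries B L).inv_mem hg).2 β |>.2 hβ) k ?_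
    rw [← map_zsmul, ← hk, LinearEquiv.inv_apply_apply]
  neg := by rw [hg.1]; exact h.neg
  reflection_mem x hx := by
    have h1 := h.reflection_mem (g⁻¹ x) (((latticeIsometries B L).inv_mem hg).2 x |>.2 hx)
    rw [← hg.2, map_sub, map_smul, LinearEquiv.apply_inv_apply] at h1
    rwa [hg.1, ← hg.1 (g⁻¹ x), LinearEquiv.apply_inv_apply] at *

theorem mem_image_iff_inv_apply_mem {D : Set V} {y : V} : y ∈ g '' D ↔ g⁻¹ y ∈ D := by
  constructor
  · rintro ⟨z, hz, rfl⟩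
    rwa [LinearEquiv.inv_apply_apply]
  · exact fun h => ⟨_, h, LinearEquiv.apply_inv_apply g y⟩

theorem form_inv_apply (hg : g ∈ latticeIsometries B L) (x y : V) :
    B (g⁻¹ x) y = B x (g y) := by
  rw [← hg.1, LinearEquiv.apply_inv_apply]

theorem weylChamber_map (hg : g ∈ latticeIsometries B L) (x : V) :
    weylChamber B L (g x) = g '' weylChamber B L x := by
  ext y
  rw [mem_image_iff_inv_apply_mem]
  have hg' := (latticeIsometries B L).inv_mem hg
  have e : ∀ z w, B (g z) w = B z (g⁻¹ w) := fun z w => by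
    rw [← hg.1 z, LinearEquiv.apply_inv_apply]
  simp only [weylChamber, posCone, Set.mem_ofPred_eq, hg'.1, e]
  refine and_congr_right fun _ => ⟨fun h α hα hx => ?_, fun h α hα hx => ?_⟩
  · have := h (g α) (hα.map hg) (by rwa [LinearEquiv.inv_apply_apply])
    rwa [form_inv_apply hg]
  · have := h (g⁻¹ α) (hα.map hg') hx
    rwa [hg'.1] at this

theorem simpleRoots_map (hg : g ∈ latticeIsometries B L) (D : Set V) :
    simpleRoots B L (g '' D) = g '' simpleRoots B L D := by
  have key : ∀ g : V ≃ₗ[ℝ] V, g ∈ latticeIsometries B L → ∀ D : Set V,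
      g '' simpleRoots B L D ⊆ simpleRoots B L (g '' D) := by
    rintro g hg D _ ⟨α, ⟨h1, h2, h3⟩, rfl⟩
    refine ⟨h1.map hg, ?_, fun y hy => ?_⟩
    · rintro _ ⟨y, hy, rfl⟩
      rw [hg.1]
      exact h2 y hy
    · have h4 := h3 (g⁻¹ y) (by rwa [form_inv_apply hg])
      have h5 := Submodule.mem_map_of_mem (f := (g : V →ₗ[ℝ] V)) h4
      rw [LinearMap.map_span] at h5
      have h6 : (g : V →ₗ[ℝ] V) (g⁻¹ y) = y := LinearEquiv.apply_inv_apply g y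
      rw [h6] at h5
      refine Submodule.span_mono ?_ h5
      rintro _ ⟨z, ⟨hz, hz'⟩, rfl⟩
      exact ⟨⟨z, hz, rfl⟩, by simpa [hg.1] using hz'⟩
  refine subset_antisymm (fun α hα => ?_) (key g hg D)
  have h := key g⁻¹ ((latticeIsometries B L).inv_mem hg) (g '' D) ⟨α, hα, rfl⟩
  rw [mem_image_iff_inv_apply_mem]
  convert h using 2
  ext y
  rw [mem_image_iff_inv_apply_mem, inv_inv, (LinearEquiv.injective g).mem_set_image]

theorem IsWeylVector.map (hg : g ∈ latticeIsometries B L) {D : Set V} {ρ : V}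
    (h : IsWeylVector B L D ρ) : IsWeylVector B L (g '' D) (g ρ) := by
  intro α hα
  have hα' := hα.map ((latticeIsometries B L).inv_mem hg)
  rw [simpleRoots_map hg, mem_image_iff_inv_apply_mem, h _ hα']
  rw [← hg.1 ρ, ← hg.1 (g⁻¹ α), LinearEquiv.apply_inv_apply]

/-- The reflection in the hyperplane orthogonal to a root, as a linear automorphism. -/
noncomputable def rootReflection {α : V} (h : IsRoot B L α) : V ≃ₗ[ℝ] V :=
  Module.reflection (x := α) (f := (2 / B α α) • LinearMap.flip B α)
    (by simpa using div_mul_cancel₀ (2 : ℝ) h.neg.ne)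

theorem rootReflection_apply {α : V} (h : IsRoot B L α) (x : V) :
    rootReflection h x = x - (2 * B x α / B α α) • α := by
  simp only [rootReflection, Module.reflection_apply, LinearMap.smul_apply, LinearMap.flip_apply,
    smul_eq_mul]
  congr 2; ring

theorem rootReflection_rootReflection {α : V} (h : IsRoot B L α) (x : V) :
    rootReflection h (rootReflection h x) = x :=
  Module.involutive_reflection _ x

theorem rootReflection_mem_latticeIsometries (hB : ∀ x y, B x y = B y x) {α : V}
    (h : IsRoot B L α) : rootReflection h ∈ latticeIsometries B L := by
  have hL : ∀ x ∈ L, rootReflection h x ∈ L := fun x hx => by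
    rw [rootReflection_apply]; exact h.reflection_mem x hx
  refine ⟨fun x y => ?_, fun x => ⟨fun hx => ?_, hL x⟩⟩
  · simp only [rootReflection_apply, map_sub, map_smul, LinearMap.sub_apply, LinearMap.smul_apply,
      smul_eq_mul]
    have := h.neg.ne
    rw [hB α y]
    field_simp
    ring
  · simpa only [rootReflection_rootReflection] using hL _ hx

theorem rootReflection_mem_reflectionGroup {α : V} (h : IsRoot B L α) :
    rootReflection h ∈ reflectionGroup B L :=
  Subgroup.subset_closure ⟨α, h, rootReflection_apply h⟩

theorem reflectionGroup_eq_closure :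
    reflectionGroup B L = Subgroup.closure {g | ∃ α, ∃ h : IsRoot B L α, g = rootReflection h} := by
  rw [reflectionGroup]
  congr 1
  ext g
  refine exists_congr fun α => ⟨fun ⟨h, hg⟩ => ⟨h, ?_⟩, fun ⟨h, hg⟩ => ⟨h, ?_⟩⟩
  · ext x; rw [hg, rootReflection_apply]
  · subst hg; exact rootReflection_apply h

theorem IsBond.map (hg : ∀ x y, B (g x) (g y) = B x y) {α β : V} {b : Bond}
    (h : IsBond B α β b) : IsBond B (g α) (g β) b := by
  unfold IsBond at h ⊢
  simpa only [hg] using h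

theorem HasDynkinDiagram.map (hg : ∀ x y, B (g x) (g y) = B x y) {ι : Type*} {S : Set V}
    {Γ : ι → ι → Bond} (h : HasDynkinDiagram B S Γ) : HasDynkinDiagram B (g '' S) Γ := by
  obtain ⟨v, h1, rfl, h3⟩ := h
  exact ⟨g ∘ v, g.injective.comp h1, Set.range_comp g v, fun i j hij => (h3 i j hij).map hg⟩

end Transport

/-! ### The roots of `E₈⁷(-2) ⊕ II₁,₁` -/

/-- The vector with coordinates `a, b, m, n` satisfies the conditions for a root of norm `-2k`. -/
structure RootCoord (k a b m n : ℤ) : Prop where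
  cases : k = 1 ∨ k = 2 ∨ k = 7 ∨ k = 14
  norm : 2 * (a ^ 2 + a * b + 2 * b ^ 2) + m * n = k
  dvd_m : k ∣ m
  dvd_n : k ∣ n
  dvd_left : k ∣ 2 * (2 * a + b)
  dvd_right : k ∣ 2 * (a + 4 * b)

theorem RootCoord.pos {k a b m n : ℤ} (h : RootCoord k a b m n) : 0 < k := by
  have := h.cases; omega

theorem RootCoord.form_self {k a b m n : ℤ} (h : RootCoord k a b m n) :
    lorentzForm (latVec a b m n) (latVec a b m n) = -2 * k := by
  rw [lorentzForm_latVec_self, ← h.norm]; push_cast; ring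

theorem RootCoord.dvd_form {k a b m n : ℤ} (h : RootCoord k a b m n) (a' b' m' n' : ℤ) :
    ∃ s : ℤ, lorentzForm (latVec a' b' m' n') (latVec a b m n) = k * s := by
  obtain ⟨-, -, ⟨p, hp⟩, ⟨q, hq⟩, ⟨r, hr⟩, ⟨s, hs⟩⟩ := h
  refine ⟨-a' * r - b' * s - m' * q - n' * p, ?_⟩
  rw [lorentzForm_latVec]
  rw [← Int.cast_mul, Int.cast_inj]
  linear_combination (-a') * hr - b' * hs - m' * hq - n' * hp

theorem RootCoord.isRoot {k a b m n : ℤ} (h : RootCoord k a b m n) :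
    IsRoot lorentzForm lorentzLattice (latVec a b m n) where
  mem := latVec_mem ..
  primitive β hβ c hc := by
    obtain ⟨a', b', m', n', rfl⟩ := (mem_lorentzLattice β).1 hβ
    rw [← Int.cast_smul_eq_zsmul ℝ, latVec_smul, latVec_inj] at hc
    obtain ⟨rfl, rfl, rfl, rfl⟩ := hc
    -- Each admissible k is squarefree, so c² ∣ k leaves only c = ±1.
    have h1 : c ^ 2 * (2 * (a' ^ 2 + a' * b' + 2 * b' ^ 2) + m' * n') = k := by
      rw [← h.norm]; ring
    generalize 2 * (a' ^ 2 + a' * b' + 2 * b' ^ 2) + m' * n' = q at h1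
    have hk := h.cases
    have hc : c ^ 2 ≤ k := Int.le_of_dvd h.pos ⟨q, h1.symm⟩
    have h2 : -3 ≤ c := by nlinarith [show k ≤ 14 by omega]
    have h3 : c ≤ 3 := by nlinarith [show k ≤ 14 by omega]
    interval_cases c <;> omega
  neg := by
    rw [h.form_self]
    have : (0 : ℝ) < k := by exact_mod_cast h.pos
    linarith
  reflection_mem x hx := by
    obtain ⟨a', b', m', n', rfl⟩ := (mem_lorentzLattice x).1 hx
    obtain ⟨s, hs⟩ := h.dvd_form a' b' m' n'
    have hk : (k : ℝ) ≠ 0 := by exact_mod_cast h.pos.ne'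
    have : 2 * lorentzForm (latVec a' b' m' n') (latVec a b m n) /
        lorentzForm (latVec a b m n) (latVec a b m n) = ((-s : ℤ) : ℝ) := by
      rw [hs, h.form_self]; push_cast; field_simp
    rw [this, latVec_smul]
    exact lorentzLattice.sub_mem (latVec_mem ..) (latVec_mem ..)

/-- Write p / k in lowest terms p' / k'. Then k' divides every coordinate of α, so primitivity makes
it a unit. -/
theorem dvd_of_smul_mem {α : LSpace} (hα : α ∈ lorentzLattice)
    (hp : ∀ β ∈ lorentzLattice, ∀ k : ℤ, α = k • β → k = 1 ∨ k = -1) {k p : ℤ} (hk : 0 < k)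
    (h : ((p : ℝ) / k) • α ∈ lorentzLattice) : k ∣ p := by
  obtain ⟨a, b, m, n, rfl⟩ := (mem_lorentzLattice α).1 hα
  obtain ⟨a', b', m', n', h'⟩ := (mem_lorentzLattice _).1 h
  have hk' : (k : ℝ) ≠ 0 := by exact_mod_cast hk.ne'
  have h2 : (p : ℝ) • latVec a b m n = (k : ℝ) • latVec a' b' m' n' := by
    rw [← h', smul_smul, mul_div_cancel₀ _ hk']
  rw [latVec_smul, latVec_smul, latVec_inj] at h2
  obtain ⟨d, p', k', hd, hcop, rfl, rfl⟩ := Int.exists_gcd_one' (m := p) (n := k)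
    (Int.gcd_pos_of_ne_zero_right _ hk.ne')
  have hd0 : (d : ℤ) ≠ 0 := by exact_mod_cast hd.ne'
  have hco : IsCoprime k' p' := (Int.isCoprime_iff_gcd_eq_one.2 hcop).symm
  have hdvd : ∀ x y : ℤ, p' * d * x = k' * d * y → k' ∣ x := fun x y hxy => by
    refine hco.dvd_of_dvd_mul_left ⟨y, mul_left_cancel₀ hd0 ?_⟩
    linear_combination hxy
  obtain ⟨ha, hb, hm, hn⟩ := h2
  obtain ⟨a₁, rfl⟩ := hdvd _ _ ha
  obtain ⟨b₁, rfl⟩ := hdvd _ _ hb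
  obtain ⟨m₁, rfl⟩ := hdvd _ _ hm
  obtain ⟨n₁, rfl⟩ := hdvd _ _ hn
  have := hp (latVec a₁ b₁ m₁ n₁) (latVec_mem ..) k' (by
    rw [← Int.cast_smul_eq_zsmul ℝ, latVec_smul])
  rcases this with rfl | rfl
  · exact ⟨p', by ring⟩
  · exact ⟨-p', by ring⟩

/-- Converse of `RootCoord.isRoot`. The reflection moves x by ((x, α) / k) α, so primitivity gives k
∣ (x, α); testing on basis vectors gives the four divisibilities. -/
theorem IsRoot.exists_rootCoord {α : LSpace} (h : IsRoot lorentzForm lorentzLattice α) :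
    ∃ k a b m n : ℤ, RootCoord k a b m n ∧ α = latVec a b m n := by
  obtain ⟨a, b, m, n, rfl⟩ := (mem_lorentzLattice α).1 h.mem
  obtain ⟨k, hk⟩ : ∃ k : ℤ, 2 * (a ^ 2 + a * b + 2 * b ^ 2) + m * n = k := ⟨_, rfl⟩
  have hnorm : lorentzForm (latVec a b m n) (latVec a b m n) = -2 * k := by
    rw [lorentzForm_latVec_self, ← hk]; push_cast; ring
  have hk0 : 0 < k := by
    have := h.neg
    rw [hnorm] at this
    have : (0 : ℝ) < k := by linarith
    exact_mod_cast this
  have hk0' : (k : ℝ) ≠ 0 := by exact_mod_cast hk0.ne'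
  have key : ∀ a' b' m' n' : ℤ,
      k ∣ -2 * (2 * a' * a + a' * b + b' * a + 4 * b' * b) - (m' * n + n' * m) := by
    intro a' b' m' n'
    refine dvd_of_smul_mem h.mem h.primitive hk0 ?_
    have h1 := h.reflection_mem _ (latVec_mem a' b' m' n')
    rw [hnorm, lorentzForm_latVec] at h1
    have h2 := lorentzLattice.sub_mem h1 (latVec_mem a' b' m' n')
    convert h2 using 1
    rw [sub_sub_cancel_left, ← neg_smul]
    congr 1
    field_simp
  have hm : k ∣ m := by have := key 0 0 0 (-1); ring_nf at this; exact this
  have hn : k ∣ n := by have := key 0 0 (-1) 0; ring_nf at this; exact this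
  have h1 : k ∣ 2 * (2 * a + b) := by
    have := key (-1) 0 0 0; ring_nf at this ⊢; exact this
  have h2 : k ∣ 2 * (a + 4 * b) := by
    have := key 0 (-1) 0 0; ring_nf at this ⊢; exact this
  refine ⟨k, a, b, m, n, ⟨?_, hk, hm, hn, h1, h2⟩, rfl⟩
  -- (14 / k) α is in the lattice: 14 a and 14 b are integral combinations of 2(2a + b) and 2(a +
  -- 4b), both divisible by k.
  have h14 : k ∣ 14 := by
    refine dvd_of_smul_mem h.mem h.primitive hk0 ?_
    have hdvd : ∀ x : ℤ, k ∣ 14 * x → ∃ y : ℤ, (14 / k : ℝ) * x = y := by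
      rintro x ⟨y, hy⟩
      refine ⟨y, ?_⟩
      have : (14 * x : ℝ) = k * y := by exact_mod_cast hy
      field_simp
      linarith
    obtain ⟨a', ha'⟩ := hdvd a (by
      obtain ⟨r, hr⟩ := h1
      obtain ⟨s, hs⟩ := h2
      exact ⟨4 * r - s, by linear_combination 4 * hr - hs⟩)
    obtain ⟨b', hb'⟩ := hdvd b (by
      obtain ⟨r, hr⟩ := h1
      obtain ⟨s, hs⟩ := h2
      exact ⟨2 * s - r, by linear_combination 2 * hs - hr⟩)
    obtain ⟨m', hm'⟩ := hdvd m (hm.mul_left _)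
    obtain ⟨n', hn'⟩ := hdvd n (hn.mul_left _)
    rw [mem_lorentzLattice]
    refine ⟨a', b', m', n', ?_⟩
    ext
    · simp only [latVec, Prod.smul_mk, smul_eq_mul]; push_cast; rw [← ha', ← hb']; ring
    · simp only [latVec, Prod.smul_mk, smul_eq_mul]; push_cast; rw [← ha']; ring
    · simp only [latVec, Prod.smul_mk, smul_eq_mul]; push_cast; rw [← hm']
    · simp only [latVec, Prod.smul_mk, smul_eq_mul]; push_cast; rw [← hn']
  have := Int.le_of_dvd (by norm_num) h14
  interval_cases k <;> omega

/-! ### The simple roots of the fundamental chamber -/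

/-- The negative of the Weyl vector, an interior point of the fundamental chamber. -/
noncomputable def basePoint : LSpace := latVec 0 (-1) 2 (-3)

/-- The simple roots of the fundamental chamber. -/
noncomputable def simpleVec : Fin 8 → LSpace :=
  ![latVec 0 (-1) 1 (-3), latVec 1 0 0 0, latVec 0 0 1 1, latVec (-1) 0 0 (-2),
    latVec (-1) 2 0 0, latVec (-2) (-3) 7 (-7), latVec 1 (-2) 0 (-14), latVec 2 (-4) 7 (-7)]

/-- The simple root with index `i` has norm `-2 * simpleIndex i`. -/
def simpleIndex : Fin 8 → ℤ := ![1, 2, 1, 2, 14, 7, 14, 7]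

theorem simpleIndex_cases (i : Fin 8) :
    simpleIndex i = 1 ∨ simpleIndex i = 2 ∨ simpleIndex i = 7 ∨ simpleIndex i = 14 := by
  revert i; decide

theorem simpleVec_rootCoord (i : Fin 8) :
    ∃ a b m n : ℤ, RootCoord (simpleIndex i) a b m n ∧ simpleVec i = latVec a b m n := by
  fin_cases i <;> refine ⟨_, _, _, _, ⟨simpleIndex_cases _, ?_, ?_, ?_, ?_, ?_⟩, rfl⟩ <;> decide

theorem simpleVec_isRoot (i : Fin 8) : IsRoot lorentzForm lorentzLattice (simpleVec i) := by
  obtain ⟨a, b, m, n, h, h'⟩ := simpleVec_rootCoord i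
  rw [h']; exact h.isRoot

theorem simpleVec_form_self (i : Fin 8) :
    lorentzForm (simpleVec i) (simpleVec i) = -2 * simpleIndex i := by
  obtain ⟨a, b, m, n, h, h'⟩ := simpleVec_rootCoord i
  rw [h', h.form_self]

theorem basePoint_form_simpleVec (i : Fin 8) :
    lorentzForm basePoint (simpleVec i) = simpleIndex i := by
  fin_cases i <;> simp [basePoint, simpleVec, simpleIndex, lorentzForm_latVec]

theorem basePoint_form_self : lorentzForm basePoint basePoint = 4 := by
  rw [basePoint, lorentzForm_latVec]; norm_num

theorem root_norms : {n : ℝ | ∃ α, IsRoot lorentzForm lorentzLattice α ∧ lorentzForm α α = n} =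
    {-2, -4, -14, -28} := by
  ext x
  simp only [Set.mem_ofPred_eq, Set.mem_insert_iff, Set.mem_singleton_iff]
  constructor
  · rintro ⟨α, h, rfl⟩
    obtain ⟨k, a, b, m, n, h', rfl⟩ := h.exists_rootCoord
    rw [h'.form_self]
    rcases h'.cases with rfl | rfl | rfl | rfl <;> norm_num
  · have := fun i => (⟨simpleVec i, simpleVec_isRoot i, simpleVec_form_self i⟩ :
      ∃ α, IsRoot lorentzForm lorentzLattice α ∧ lorentzForm α α = -2 * simpleIndex i)
    rintro (rfl | rfl | rfl | rfl)
    · convert this 0; simp [simpleIndex]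
    · convert this 1; simp [simpleIndex]; norm_num
    · convert this 5; simp [simpleIndex]; norm_num
    · convert this 4; simp [simpleIndex]; norm_num

/-! ### Roots of small height. -/

theorem basePoint_form_latVec (a b m n : ℤ) :
    lorentzForm basePoint (latVec a b m n) = ((2 * a + 8 * b + 3 * m - 2 * n : ℤ) : ℝ) := by
  rw [basePoint, lorentzForm_latVec]; congr 1; ring

/-- With X = a + 4b + 2m and height h, any vector v satisfies 2X² + 14a² + (2m - h)² = h² - 4v². The
left side is a positive definite form on the complement of `basePoint`, so for given height and norm
only finitely many cases remain. Here h = 0 and v² = -2k. -/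
theorem RootCoord.height_ne_zero {k a b m n : ℤ} (h : RootCoord k a b m n) :
    2 * a + 8 * b + 3 * m - 2 * n ≠ 0 := by
  intro h0
  obtain ⟨hk, hq, ⟨m, rfl⟩, ⟨n, rfl⟩, h1, h2⟩ := h
  obtain ⟨X, hX⟩ : ∃ X, X = a + 4 * b + 2 * (k * m) := ⟨_, rfl⟩
  have key : X ^ 2 + 7 * a ^ 2 + 2 * (k * m) ^ 2 = 4 * k := by
    rw [hX]; linear_combination 4 * hq + 2 * (k * m) * h0
  rcases hk with rfl | rfl | rfl | rfl
  · have ha : a = 0 := by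
      have : -1 < a ∧ a < 1 := by constructor <;> nlinarith
      omega
    subst ha
    have hm : -1 ≤ m ∧ m ≤ 1 := by constructor <;> nlinarith
    have hX' : -2 ≤ X ∧ X ≤ 2 := by constructor <;> nlinarith
    obtain ⟨⟨hm, hm'⟩, hXl, hXu⟩ := And.intro hm hX'
    interval_cases m <;> interval_cases X <;> omega
  · have ha : -1 ≤ a ∧ a ≤ 1 := by constructor <;> nlinarith
    have hm : -1 ≤ m ∧ m ≤ 1 := by constructor <;> nlinarith
    have hX' : -2 ≤ X ∧ X ≤ 2 := by constructor <;> nlinarith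
    obtain ⟨⟨ha, ha'⟩, ⟨hm, hm'⟩, hXl, hXu⟩ := And.intro ha (And.intro hm hX')
    interval_cases a <;> interval_cases m <;> interval_cases X <;> omega
  · have ha : -2 ≤ a ∧ a ≤ 2 := by constructor <;> nlinarith
    have hm : m = 0 := by
      have : -1 < m ∧ m < 1 := by constructor <;> nlinarith
      omega
    subst hm
    have hX' : -5 ≤ X ∧ X ≤ 5 := by constructor <;> nlinarith
    obtain ⟨⟨ha, ha'⟩, hXl, hXu⟩ := And.intro ha hX'
    interval_cases a <;> interval_cases X <;> omega
  · have ha : -2 ≤ a ∧ a ≤ 2 := by constructor <;> nlinarith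
    have hm : m = 0 := by
      have : -1 < m ∧ m < 1 := by constructor <;> nlinarith
      omega
    subst hm
    have hX' : -7 ≤ X ∧ X ≤ 7 := by constructor <;> nlinarith
    obtain ⟨⟨ha, ha'⟩, hXl, hXu⟩ := And.intro ha hX'
    interval_cases a <;> interval_cases X <;> omega

theorem RootCoord.eq_of_height_eq {k a b m n : ℤ} (h : RootCoord k a b m n)
    (h0 : 2 * a + 8 * b + 3 * m - 2 * n = k) :
    ∃ i, simpleIndex i = k ∧ latVec a b m n = simpleVec i := by
  suffices (k = 1 ∧ a = 0 ∧ b = -1 ∧ m = 1 ∧ n = -3) ∨ (k = 2 ∧ a = 1 ∧ b = 0 ∧ m = 0 ∧ n = 0) ∨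
      (k = 1 ∧ a = 0 ∧ b = 0 ∧ m = 1 ∧ n = 1) ∨ (k = 2 ∧ a = -1 ∧ b = 0 ∧ m = 0 ∧ n = -2) ∨
      (k = 14 ∧ a = -1 ∧ b = 2 ∧ m = 0 ∧ n = 0) ∨ (k = 7 ∧ a = -2 ∧ b = -3 ∧ m = 7 ∧ n = -7) ∨
      (k = 14 ∧ a = 1 ∧ b = -2 ∧ m = 0 ∧ n = -14) ∨
      (k = 7 ∧ a = 2 ∧ b = -4 ∧ m = 7 ∧ n = -7) by
    rcases this with ⟨rfl, rfl, rfl, rfl, rfl⟩ | ⟨rfl, rfl, rfl, rfl, rfl⟩ |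
      ⟨rfl, rfl, rfl, rfl, rfl⟩ | ⟨rfl, rfl, rfl, rfl, rfl⟩ | ⟨rfl, rfl, rfl, rfl, rfl⟩ |
      ⟨rfl, rfl, rfl, rfl, rfl⟩ | ⟨rfl, rfl, rfl, rfl, rfl⟩ | ⟨rfl, rfl, rfl, rfl, rfl⟩
    exacts [⟨0, rfl, rfl⟩, ⟨1, rfl, rfl⟩, ⟨2, rfl, rfl⟩, ⟨3, rfl, rfl⟩, ⟨4, rfl, rfl⟩,
      ⟨5, rfl, rfl⟩, ⟨6, rfl, rfl⟩, ⟨7, rfl, rfl⟩]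
  obtain ⟨hk, hq, ⟨m, rfl⟩, ⟨n, rfl⟩, h1, h2⟩ := h
  obtain ⟨X, hX⟩ : ∃ X, X = a + 4 * b + 2 * (k * m) := ⟨_, rfl⟩
  -- The same sum of squares, now with h = k and v² = -2k.
  have key : 2 * X ^ 2 + 14 * a ^ 2 + (2 * (k * m) - k) ^ 2 = 8 * k + k ^ 2 := by
    rw [hX]; linear_combination 8 * hq + 4 * (k * m) * h0
  have ha2 := sq_nonneg a
  have hX2 := sq_nonneg X
  have hm2 := sq_nonneg (2 * (k * m) - k)
  clear hq
  rcases hk with rfl | rfl | rfl | rfl <;> norm_num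
  · obtain ⟨ha, ha'⟩ := abs_lt_of_sq_lt_sq' (a := a) (b := 1) (by linarith) (by norm_num)
    obtain ⟨hm, hm'⟩ := abs_lt_of_sq_lt_sq' (a := 2 * (1 * m) - 1) (b := 4) (by linarith)
      (by norm_num)
    obtain ⟨hXl, hXu⟩ := abs_lt_of_sq_lt_sq' (a := X) (b := 3) (by linarith) (by norm_num)
    obtain rfl : a = 0 := by omega
    obtain ⟨hm, hm'⟩ : -1 ≤ m ∧ m ≤ 2 := by omega
    interval_cases m <;> interval_cases X <;> omega
  · obtain ⟨ha, ha'⟩ := abs_lt_of_sq_lt_sq' (a := a) (b := 2) (by linarith) (by norm_num)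
    obtain ⟨hm, hm'⟩ := abs_lt_of_sq_lt_sq' (a := 2 * (2 * m) - 2) (b := 5) (by linarith)
      (by norm_num)
    obtain ⟨hXl, hXu⟩ := abs_lt_of_sq_lt_sq' (a := X) (b := 4) (by linarith) (by norm_num)
    obtain ⟨hm, hm'⟩ : 0 ≤ m ∧ m ≤ 1 := by omega
    interval_cases a <;> interval_cases m <;> interval_cases X <;> omega
  · obtain ⟨hm, hm'⟩ := abs_lt_of_sq_lt_sq' (a := 2 * (7 * m) - 7) (b := 11) (by linarith)
      (by norm_num)
    have hm : m = 0 ∨ m = 1 := by omega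
    have key : X ^ 2 + 7 * a ^ 2 = 28 := by rcases hm with rfl | rfl <;> linarith
    obtain ⟨ha, ha'⟩ := abs_lt_of_sq_lt_sq' (a := a) (b := 3) (by linarith) (by norm_num)
    obtain ⟨hXl, hXu⟩ := abs_lt_of_sq_lt_sq' (a := X) (b := 6) (by linarith) (by norm_num)
    rcases hm with rfl | rfl <;> interval_cases a <;> interval_cases X <;> omega
  · obtain ⟨hm, hm'⟩ := abs_lt_of_sq_lt_sq' (a := 2 * (14 * m) - 14) (b := 18) (by linarith)
      (by norm_num)
    have hm : m = 0 ∨ m = 1 := by omega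
    have key : X ^ 2 + 7 * a ^ 2 = 56 := by rcases hm with rfl | rfl <;> linarith
    obtain ⟨ha, ha'⟩ := abs_lt_of_sq_lt_sq' (a := a) (b := 3) (by linarith) (by norm_num)
    obtain ⟨hXl, hXu⟩ := abs_lt_of_sq_lt_sq' (a := X) (b := 8) (by linarith) (by norm_num)
    rcases hm with rfl | rfl <;> interval_cases a <;> interval_cases X <;> omega

/-! ### Positive roots are nonnegative combinations of the simple roots -/

/-- The Gram matrix of the simple roots. -/
def simpleGram : Fin 8 → Fin 8 → ℤ :=
  ![![-2, 2, 2, 0, 14, 0, 0, 0], ![2, -4, 0, 4, 0, 14, 0, 0], ![2, 0, -2, 2, 0, 0, 14, 0],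
    ![0, 4, 2, -4, 0, 0, 0, 14], ![14, 0, 0, 0, -28, 42, 28, 56], ![0, 14, 0, 0, 42, -14, 56, 14],
    ![0, 0, 14, 0, 28, 56, -28, 42], ![0, 0, 0, 14, 56, 14, 42, -14]]

theorem simpleVec_form_simpleVec (i j : Fin 8) :
    lorentzForm (simpleVec i) (simpleVec j) = simpleGram i j := by
  fin_cases i <;> fin_cases j <;> simp [simpleVec, lorentzForm_latVec, simpleGram]

theorem simpleVec_form_nonneg {i j : Fin 8} (h : i ≠ j) :
    0 ≤ lorentzForm (simpleVec i) (simpleVec j) := by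
  rw [simpleVec_form_simpleVec]
  have : 0 ≤ simpleGram i j := by revert i j; decide
  exact_mod_cast this

theorem simpleVec_injective : Function.Injective simpleVec := by
  intro i j h
  by_contra hij
  have h1 := simpleVec_form_nonneg hij
  rw [h] at h1
  exact absurd (simpleVec_isRoot j).neg (not_lt.2 h1)

/-- Up to the factor 28, the inverse form is the symmetrised sum of the tensors αᵢ ⊗ αᵢ₊₄ for i < 4.
All coefficients are positive, so products with the simple roots control the sign of the form. -/
theorem lorentzForm_eq_sum_mul (x y : LSpace) :
    28 * lorentzForm x y =
      lorentzForm x (simpleVec 0) * lorentzForm y (simpleVec 4) +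
      lorentzForm x (simpleVec 4) * lorentzForm y (simpleVec 0) +
      lorentzForm x (simpleVec 1) * lorentzForm y (simpleVec 5) +
      lorentzForm x (simpleVec 5) * lorentzForm y (simpleVec 1) +
      lorentzForm x (simpleVec 2) * lorentzForm y (simpleVec 6) +
      lorentzForm x (simpleVec 6) * lorentzForm y (simpleVec 2) +
      lorentzForm x (simpleVec 3) * lorentzForm y (simpleVec 7) +
      lorentzForm x (simpleVec 7) * lorentzForm y (simpleVec 3) := by
  simp [lorentzForm_apply, simpleVec, latVec]
  ring

theorem lorentzForm_self_nonneg {y : LSpace} (h : ∀ i, 0 ≤ lorentzForm y (simpleVec i)) :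
    0 ≤ lorentzForm y y := by
  have := lorentzForm_eq_sum_mul y y
  have h1 := mul_nonneg (h 0) (h 4)
  have h2 := mul_nonneg (h 1) (h 5)
  have h3 := mul_nonneg (h 2) (h 6)
  have h4 := mul_nonneg (h 3) (h 7)
  linarith

theorem IsRoot.exists_form_neg {α : LSpace} (h : IsRoot lorentzForm lorentzLattice α) :
    ∃ i, lorentzForm α (simpleVec i) < 0 := by
  by_contra! h'
  exact absurd h.neg (not_lt.2 (lorentzForm_self_nonneg h'))

theorem lorentzForm_nonpos_of_orthogonal_basePoint {z : LSpace} (h : lorentzForm basePoint z = 0) :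
    lorentzForm z z ≤ 0 := by
  obtain ⟨⟨p, q⟩, m, n⟩ := z
  simp only [basePoint, latVec, lorentzForm_apply] at h ⊢
  push_cast at h
  have hn : n = 2 * p + 3 / 2 * m := by linarith
  subst hn
  nlinarith [sq_nonneg (p + m), sq_nonneg m, sq_nonneg q]

/-- Cauchy–Schwarz for the projections of x and z to the complement of `basePoint`, where minus the
form is nonnegative. The hypothesis says that the projection of z has negative norm. -/
theorem cauchySchwarz_basePoint (x z : LSpace)
    (hz : lorentzForm z z < lorentzForm basePoint z ^ 2 / 4) :
    (lorentzForm x z - lorentzForm basePoint x * lorentzForm basePoint z / 4) ^ 2 ≤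
      (lorentzForm basePoint x ^ 2 / 4 - lorentzForm x x) *
        (lorentzForm basePoint z ^ 2 / 4 - lorentzForm z z) := by
  set h := lorentzForm basePoint x with hh
  set k := lorentzForm basePoint z with hk
  set c := lorentzForm x z - h * k / 4 with hc
  set D := k ^ 2 / 4 - lorentzForm z z with hD
  have hD0 : 0 < D := by linarith
  -- With x', z' the projections, D = -z'² and c = (x', z'), the vector D x' + c z' has norm D (D
  -- x'² + c²), which must be nonpositive.
  have h1 := lorentzForm_nonpos_of_orthogonal_basePoint
    (z := D • (x - (h / 4) • basePoint) + c • (z - (k / 4) • basePoint)) (by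
      simp only [map_add, map_sub, map_smul, smul_eq_mul, basePoint_form_self, ← hh, ← hk]
      ring)
  simp only [map_add, map_sub, map_smul, smul_eq_mul, LinearMap.add_apply, LinearMap.sub_apply,
    LinearMap.smul_apply, basePoint_form_self, lorentzForm_comm _ basePoint,
    lorentzForm_comm z x, ← hh, ← hk] at h1
  have h2 : D * (c ^ 2 - (h ^ 2 / 4 - lorentzForm x x) * D) ≤ 0 := by
    have e1 : lorentzForm x z = c + h * k / 4 := by rw [hc]; ring
    have e2 : lorentzForm z z = k ^ 2 / 4 - D := by rw [hD]; ring
    rw [e1, e2] at h1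
    linarith
  by_contra! h3
  exact absurd h2 (not_le.2 (mul_pos hD0 (by linarith)))

/-- Arithmetic core of the next positivity statement: the root has norm -2k and height kt, its
product with a simple root of norm -2l is -ku, and the inequality is Cauchy–Schwarz with
denominators cleared. -/
theorem height_eq_one_of_bound {k l t u : ℤ} (hk : k = 1 ∨ k = 2 ∨ k = 7 ∨ k = 14)
    (hl : l = 1 ∨ l = 2 ∨ l = 7 ∨ l = 14) (ht : 0 < t) (hu : t < u) (hd : l ∣ k * u)
    (h : k * (4 * u ^ 2 + 2 * l * (t * (u - t))) ≤ 2 * (8 * l + l ^ 2)) : t = 1 := by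
  by_contra h1
  have h2 : u - 1 ≤ t * (u - t) := by 
    nlinarith [mul_nonneg (sub_nonneg.2 (show 1 ≤ t by omega))
      (sub_nonneg.2 (show t + 1 ≤ u by omega))]
  have h3 : 3 ≤ u := by omega
  generalize t * (u - t) = w at h h2
  have h4 : ∀ c, c ≤ u → c * u ≤ u ^ 2 := fun c hc => by nlinarith
  have h5 := h4 3 h3
  -- If the bound u ≥ 3 is not enough, l ∣ k u makes u a multiple of 2, 7 or 14, hence u ≥ 4, 7 or
  -- 14.
  rcases hl with rfl | rfl | rfl | rfl <;> rcases hk with rfl | rfl | rfl | rfl <;>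
    first
    | linarith
    | linarith [h4 4 (by omega), (show 4 ≤ u by omega)]
    | linarith [h4 7 (by omega), (show 7 ≤ u by omega)]
    | linarith [h4 14 (by omega), (show 14 ≤ u by omega)]

theorem IsRoot.height_ne_zero {α : LSpace} (h : IsRoot lorentzForm lorentzLattice α) :
    lorentzForm basePoint α ≠ 0 := by
  obtain ⟨k, a, b, m, n, h', rfl⟩ := h.exists_rootCoord
  rw [basePoint_form_latVec]
  exact_mod_cast h'.height_ne_zero

theorem mem_range_simpleVec_iff {α : LSpace} (h : IsRoot lorentzForm lorentzLattice α) :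
    α ∈ Set.range simpleVec ↔ lorentzForm basePoint α = -lorentzForm α α / 2 := by
  constructor
  · rintro ⟨i, rfl⟩
    rw [basePoint_form_simpleVec, simpleVec_form_self]; ring
  · intro h1
    obtain ⟨k, a, b, m, n, h', rfl⟩ := h.exists_rootCoord
    rw [basePoint_form_latVec, h'.form_self] at h1
    have h2 : ((2 * a + 8 * b + 3 * m - 2 * n : ℤ) : ℝ) = k := by rw [h1]; ring
    obtain ⟨i, -, hi⟩ := h'.eq_of_height_eq (by exact_mod_cast h2)
    exact ⟨i, hi.symm⟩

/-- The reflection in a simple root. -/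
noncomputable def simpleReflection (i : Fin 8) : LSpace ≃ₗ[ℝ] LSpace :=
  rootReflection (simpleVec_isRoot i)

theorem simpleIndex_pos (i : Fin 8) : 0 < simpleIndex i := by
  have := simpleIndex_cases i; omega

theorem simpleReflection_apply (i : Fin 8) (x : LSpace) :
    simpleReflection i x = x + (lorentzForm x (simpleVec i) / simpleIndex i) • simpleVec i := by
  have : (simpleIndex i : ℝ) ≠ 0 := by exact_mod_cast (simpleIndex_pos i).ne'
  rw [simpleReflection, rootReflection_apply, simpleVec_form_self, sub_eq_add_neg, ← neg_smul]
  congr 2; field_simp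

theorem simpleReflection_mem_latticeIsometries (i : Fin 8) :
    simpleReflection i ∈ latticeIsometries lorentzForm lorentzLattice :=
  rootReflection_mem_latticeIsometries lorentzForm_comm _

theorem basePoint_form_simpleReflection (i : Fin 8) (x : LSpace) :
    lorentzForm basePoint (simpleReflection i x) =
      lorentzForm basePoint x + lorentzForm x (simpleVec i) := by
  have : (simpleIndex i : ℝ) ≠ 0 := by exact_mod_cast (simpleIndex_pos i).ne'
  rw [simpleReflection_apply, map_add, map_smul, basePoint_form_simpleVec, smul_eq_mul,
    div_mul_cancel₀ _ this]

/-- As for finite root systems, a simple reflection makes no positive root negative except its own.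
A violation would force height k by Cauchy–Schwarz, so the root would be another simple root; but
distinct simple roots have nonnegative product. -/
theorem IsRoot.height_simpleReflection_pos {α : LSpace} (h : IsRoot lorentzForm lorentzLattice α)
    (hpos : 0 < lorentzForm basePoint α) {i : Fin 8} (hi : α ≠ simpleVec i) :
    0 < lorentzForm basePoint (simpleReflection i α) := by
  have hne := (h.map (simpleReflection_mem_latticeIsometries i)).height_ne_zero
  refine lt_of_le_of_ne ?_ hne.symm
  by_contra! hlt
  rw [basePoint_form_simpleReflection] at hlt
  obtain ⟨k, a, b, m, n, h', rfl⟩ := h.exists_rootCoord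
  obtain ⟨a', b', m', n', hi', hi''⟩ := simpleVec_rootCoord i
  -- These are the coordinates of `basePoint`, so k divides the height.
  obtain ⟨t, ht⟩ := h'.dvd_form 0 (-1) 2 (-3)
  obtain ⟨s, hs⟩ := h'.dvd_form a' b' m' n'
  obtain ⟨r, hr⟩ := hi'.dvd_form a b m n
  rw [← hi''] at hs hr
  rw [lorentzForm_comm] at hs
  have hk0 : (0 : ℝ) < k := by exact_mod_cast h'.pos
  have hl0 : (0 : ℝ) < simpleIndex i := by exact_mod_cast hi'.pos
  have ht' : lorentzForm basePoint (latVec a b m n) = k * t := ht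
  rw [ht'] at hpos
  rw [ht', hs] at hlt
  have ht0 : 0 < t := by
    have := pos_of_mul_pos_right hpos hk0.le
    exact_mod_cast this
  have hu0 : t < -s := by
    have : (t : ℝ) + s < 0 := by nlinarith
    have : t + s < 0 := by exact_mod_cast this
    omega
  have hd : simpleIndex i ∣ k * -s := by
    refine ⟨-r, ?_⟩
    have h1 : (k * s : ℝ) = simpleIndex i * r := by rw [← hs, hr]
    have h2 : k * s = simpleIndex i * r := by exact_mod_cast h1
    linear_combination -h2
  have hcs := cauchySchwarz_basePoint (latVec a b m n) (simpleVec i) (by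
    rw [simpleVec_form_self]
    nlinarith [sq_nonneg (lorentzForm basePoint (simpleVec i))])
  rw [ht', hs, simpleVec_form_self, basePoint_form_simpleVec, h'.form_self] at hcs
  have hb : (k * (4 * (-s) ^ 2 + 2 * simpleIndex i * (t * (-s - t))) : ℝ) ≤
      2 * (8 * simpleIndex i + (simpleIndex i) ^ 2) := by
    refine le_of_mul_le_mul_left ?_ hk0
    linarith
  have ht1 := height_eq_one_of_bound h'.cases hi'.cases ht0 hu0 hd (by exact_mod_cast hb)
  subst ht1
  obtain ⟨j, hj⟩ := (mem_range_simpleVec_iff h).2 (by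
    rw [ht', h'.form_self]; push_cast; ring)
  rw [← hj] at hi hs
  have hij : j ≠ i := fun e => hi (by rw [e])
  have h1 := simpleVec_form_nonneg hij
  rw [hs] at h1
  have h2 : (0 : ℝ) ≤ s := nonneg_of_mul_nonneg_right h1 hk0
  have h3 : 0 ≤ s := by exact_mod_cast h2
  omega

theorem IsRoot.exists_descent {α : LSpace} (h : IsRoot lorentzForm lorentzLattice α)
    (hpos : 0 < lorentzForm basePoint α) (hα : α ∉ Set.range simpleVec) :
    ∃ i, ∃ q : ℝ, ∃ β, 0 < q ∧ IsRoot lorentzForm lorentzLattice β ∧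
      0 < lorentzForm basePoint β ∧ lorentzForm basePoint β < lorentzForm basePoint α ∧
      α = β + q • simpleVec i := by
  obtain ⟨i, hi⟩ := h.exists_form_neg
  have hl0 : (0 : ℝ) < simpleIndex i := by exact_mod_cast simpleIndex_pos i
  refine ⟨i, -(lorentzForm α (simpleVec i) / simpleIndex i), simpleReflection i α, ?_,
    h.map (simpleReflection_mem_latticeIsometries i),
    h.height_simpleReflection_pos hpos fun e => hα ⟨i, e.symm⟩, ?_, ?_⟩
  · have := div_neg_of_neg_of_pos hi hl0
    linarith
  · rw [basePoint_form_simpleReflection]; linarith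
  · rw [simpleReflection_apply, neg_smul]; abel

theorem IsRoot.exists_int_height {α : LSpace} (h : IsRoot lorentzForm lorentzLattice α) :
    ∃ t : ℤ, lorentzForm basePoint α = t := by
  obtain ⟨k, a, b, m, n, -, rfl⟩ := h.exists_rootCoord
  exact ⟨_, basePoint_form_latVec ..⟩

/-- Induction on the height, a positive integer that `IsRoot.exists_descent` strictly lowers. -/
theorem IsRoot.eq_sum_of_pos {α : LSpace} (h : IsRoot lorentzForm lorentzLattice α)
    (hpos : 0 < lorentzForm basePoint α) :
    ∃ c : Fin 8 → ℝ, (∀ i, 0 ≤ c i) ∧ α = ∑ i, c i • simpleVec i := by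
  obtain ⟨t, ht⟩ := h.exists_int_height
  induction' hN : t.toNat using Nat.strong_induction_on with N ih generalizing α t
  by_cases hα : α ∈ Set.range simpleVec
  · obtain ⟨i, rfl⟩ := hα
    refine ⟨Pi.single i 1, fun j => ?_, ?_⟩
    · by_cases hij : j = i
      · subst hij; simp
      · simp [hij]
    · simp [Pi.single_apply]
  · obtain ⟨i, q, β, hq, hβ, hβ0, hβα, rfl⟩ := h.exists_descent hpos hα
    obtain ⟨s, hs⟩ := hβ.exists_int_height
    have hs0 : 0 < s := by rw [hs] at hβ0; exact_mod_cast hβ0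
    have hst : s < t := by rw [hs, ht] at hβα; exact_mod_cast hβα
    obtain ⟨c, hc, hc'⟩ := ih s.toNat (by omega) hβ hβ0 s hs rfl
    refine ⟨c + Pi.single i q, fun j => ?_, ?_⟩
    · have : 0 ≤ (Pi.single i q : Fin 8 → ℝ) j := by
        by_cases hij : j = i
        · subst hij; simpa using hq.le
        · simp [hij]
      exact add_nonneg (hc j) this
    · simp only [Pi.add_apply, add_smul, Finset.sum_add_distrib, ← hc']
      simp [Pi.single_apply]

theorem IsRoot.form_nonneg {α : LSpace} (h : IsRoot lorentzForm lorentzLattice α)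
    (hpos : 0 < lorentzForm basePoint α) {y : LSpace}
    (hy : ∀ i, 0 ≤ lorentzForm y (simpleVec i)) : 0 ≤ lorentzForm y α := by
  obtain ⟨c, hc, rfl⟩ := h.eq_sum_of_pos hpos
  simp only [map_sum, map_smul, smul_eq_mul]
  exact Finset.sum_nonneg fun i _ => mul_nonneg (hc i) (hy i)

theorem IsRoot.form_pos {α : LSpace} (h : IsRoot lorentzForm lorentzLattice α)
    (hpos : 0 < lorentzForm basePoint α) {y : LSpace}
    (hy : ∀ i, 0 < lorentzForm y (simpleVec i)) : 0 < lorentzForm y α := by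
  obtain ⟨c, hc, rfl⟩ := h.eq_sum_of_pos hpos
  have hc0 : ∃ i, c i ≠ 0 := by
    by_contra! h0
    simp [h0] at hpos
  obtain ⟨i, hi⟩ := hc0
  simp only [map_sum, map_smul, smul_eq_mul]
  exact Finset.sum_pos' (fun i _ => mul_nonneg (hc i) (hy i).le)
    ⟨i, Finset.mem_univ i, mul_pos (lt_of_le_of_ne (hc i) hi.symm) (hy i)⟩

theorem IsRoot.neg_isRoot {α : LSpace} (h : IsRoot lorentzForm lorentzLattice α) :
    IsRoot lorentzForm lorentzLattice (-α) := by
  have : (LinearEquiv.neg ℝ : LSpace ≃ₗ[ℝ] LSpace) ∈ latticeIsometries lorentzForm lorentzLattice :=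
    ⟨fun x y => by simp, fun x => by simp⟩
  simpa using h.map this

theorem IsRoot.form_pos_iff {α : LSpace} (h : IsRoot lorentzForm lorentzLattice α) {y : LSpace}
    (hy : ∀ i, 0 < lorentzForm y (simpleVec i)) :
    0 < lorentzForm y α ↔ 0 < lorentzForm basePoint α := by
  refine ⟨fun h1 => ?_, fun h1 => h.form_pos h1 hy⟩
  by_contra! h2
  have h3 := lt_of_le_of_ne h2 h.height_ne_zero
  have h4 := h.neg_isRoot.form_pos (by simpa using h3) hy
  simp only [map_neg] at h4
  linarith

/-! ### The fundamental chamber -/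

/-- The fundamental chamber. -/
def fundChamber : Set LSpace :=
  {y | 0 < lorentzForm y y ∧ ∀ i, 0 ≤ lorentzForm y (simpleVec i)}

/-- Otherwise every term of `lorentzForm_eq_sum_mul` for (x, y) vanishes. Then y is orthogonal to
the first four simple roots, and the same identity gives y² = 0. -/
theorem form_pos_of_mem_fundChamber {x y : LSpace} (hx : ∀ i, 0 < lorentzForm x (simpleVec i))
    (hy : y ∈ fundChamber) : 0 < lorentzForm x y := by
  obtain ⟨hy0, hy⟩ := hy
  have h1 := lorentzForm_eq_sum_mul x y
  have h2 := lorentzForm_eq_sum_mul y y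
  have key : ∀ i j, 0 ≤ lorentzForm x (simpleVec i) * lorentzForm y (simpleVec j) :=
    fun i j => mul_nonneg (hx i).le (hy j)
  have k0 := key 4 0
  have k1 := key 5 1
  have k2 := key 6 2
  have k3 := key 7 3
  have k4 := key 0 4
  have k5 := key 1 5
  have k6 := key 2 6
  have k7 := key 3 7
  by_contra! h
  have z0 := (mul_eq_zero.1 (show _ = 0 by linarith : lorentzForm x (simpleVec 4) *
    lorentzForm y (simpleVec 0) = 0)).resolve_left (hx _).ne'
  have z1 := (mul_eq_zero.1 (show _ = 0 by linarith : lorentzForm x (simpleVec 5) *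
    lorentzForm y (simpleVec 1) = 0)).resolve_left (hx _).ne'
  have z2 := (mul_eq_zero.1 (show _ = 0 by linarith : lorentzForm x (simpleVec 6) *
    lorentzForm y (simpleVec 2) = 0)).resolve_left (hx _).ne'
  have z3 := (mul_eq_zero.1 (show _ = 0 by linarith : lorentzForm x (simpleVec 7) *
    lorentzForm y (simpleVec 3) = 0)).resolve_left (hx _).ne'
  rw [z0, z1, z2, z3] at h2
  linarith

theorem weylChamber_eq_fundChamber {x : LSpace} (hx : ∀ i, 0 < lorentzForm x (simpleVec i)) :
    weylChamber lorentzForm lorentzLattice x = fundChamber := by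
  ext y
  constructor
  · rintro ⟨⟨h1, -⟩, h2⟩
    exact ⟨h1, fun i => h2 _ (simpleVec_isRoot i) (hx i)⟩
  · intro h
    exact ⟨⟨h.1, form_pos_of_mem_fundChamber hx h⟩, fun α hα hxα =>
      hα.form_nonneg ((hα.form_pos_iff hx).1 hxα) h.2⟩

theorem basePoint_form_simpleVec_pos (i : Fin 8) : 0 < lorentzForm basePoint (simpleVec i) := by
  rw [basePoint_form_simpleVec]
  exact_mod_cast simpleIndex_pos i

theorem isWeylChamber_fundChamber : IsWeylChamber lorentzForm lorentzLattice fundChamber :=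
  ⟨basePoint, by rw [basePoint_form_self]; norm_num, fun _ h => h.height_ne_zero,
    (weylChamber_eq_fundChamber basePoint_form_simpleVec_pos).symm⟩

/-- A point in the relative interior of the face of the fundamental chamber given by a simple
root. -/
noncomputable def facePoint : Fin 8 → LSpace :=
  ![latVec 1 (-8) 12 (-26), latVec 3 (-6) 10 (-19), latVec (-1) (-4) 12 (-12),
    latVec (-3) (-4) 10 (-17), latVec (-1) 0 3 (-4), latVec (-2) (-4) 9 (-11),
    latVec 1 (-3) 3 (-14), latVec 2 (-5) 9 (-11)]

theorem facePoint_form_self_eq_zero (i : Fin 8) : lorentzForm (facePoint i) (simpleVec i) = 0 := by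
  fin_cases i <;> simp [simpleVec, lorentzForm_latVec, facePoint]

theorem facePoint_form_pos {i j : Fin 8} (h : j ≠ i) :
    0 < lorentzForm (facePoint i) (simpleVec j) := by
  fin_cases i <;> fin_cases j <;>
    first
    | exact absurd rfl h
    | simp [simpleVec, lorentzForm_latVec, facePoint]

theorem facePoint_mem (i : Fin 8) : facePoint i ∈ fundChamber := by
  have h : ∀ j, 0 ≤ lorentzForm (facePoint i) (simpleVec j) := fun j => by
    by_cases hj : j = i
    · rw [hj, facePoint_form_self_eq_zero]
    · exact (facePoint_form_pos hj).le
  refine ⟨?_, h⟩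
  fin_cases i <;> simp [lorentzForm_latVec, facePoint]

/-- Adding a large multiple of `facePoint i` pushes any vector of the hyperplane into the face, so
the face spans the hyperplane. -/
theorem simpleVec_mem_simpleRoots (i : Fin 8) :
    simpleVec i ∈ simpleRoots lorentzForm lorentzLattice fundChamber := by
  refine ⟨simpleVec_isRoot i, fun y hy => hy.2 i, fun y hy => ?_⟩
  obtain ⟨N, hN0, hN⟩ : ∃ N : ℝ, 0 < N ∧
      ∀ j, j ≠ i → 0 < lorentzForm (y + N • facePoint i) (simpleVec j) := by
    have key : ∀ᶠ N : ℝ in Filter.atTop, 0 < N ∧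
        ∀ j, j ≠ i → 0 < lorentzForm (y + N • facePoint i) (simpleVec j) := by
      refine (Filter.eventually_gt_atTop 0).and (Filter.eventually_all.2 fun j => ?_)
      by_cases hj : j = i
      · exact Filter.Eventually.of_forall fun N h => absurd hj h
      · have h1 := facePoint_form_pos hj
        filter_upwards [Filter.eventually_gt_atTop
          (-lorentzForm y (simpleVec j) / lorentzForm (facePoint i) (simpleVec j))] with N hN _
        rw [div_lt_iff₀ h1] at hN
        simp only [map_add, map_smul, LinearMap.add_apply, LinearMap.smul_apply, smul_eq_mul]
        linarith
    exact key.exists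
  set z := y + N • facePoint i with hz
  have hzi : lorentzForm z (simpleVec i) = 0 := by
    simp only [hz, map_add, map_smul, LinearMap.add_apply, LinearMap.smul_apply, smul_eq_mul, hy,
      facePoint_form_self_eq_zero, mul_zero, add_zero]
  have hz0 : ∀ j, 0 ≤ lorentzForm z (simpleVec j) := fun j => by
    by_cases hj : j = i
    · rw [hj, hzi]
    · exact (hN j hj).le
  have hzz : z ∈ fundChamber := by
    refine ⟨?_, hz0⟩
    have h1 := lorentzForm_eq_sum_mul z z
    have k0 := mul_nonneg (hz0 0) (hz0 4)
    have k1 := mul_nonneg (hz0 1) (hz0 5)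
    have k2 := mul_nonneg (hz0 2) (hz0 6)
    have k3 := mul_nonneg (hz0 3) (hz0 7)
    -- A pair (j, j + 4) that avoids i contributes a strictly positive term to the norm of z.
    by_cases hi : i = 0 ∨ i = 4
    · have := mul_pos (hN 1 (by rintro rfl; revert hi; decide))
        (hN 5 (by rintro rfl; revert hi; decide))
      linarith
    · have := mul_pos (hN 0 (by rintro rfl; revert hi; decide))
        (hN 4 (by rintro rfl; revert hi; decide))
      linarith
  have hy' : y = z - N • facePoint i := by rw [hz]; abel
  rw [hy']
  exact Submodule.sub_mem _ (Submodule.subset_span ⟨hzz, hzi⟩)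
    (Submodule.smul_mem _ _ (Submodule.subset_span
      ⟨facePoint_mem i, facePoint_form_self_eq_zero i⟩))

theorem lorentzForm_nondegenerate {x : LSpace} (h : ∀ y, lorentzForm y x = 0) : x = 0 := by
  obtain ⟨⟨p, q⟩, m, n⟩ := x
  have h1 := h ((1, 0), (0, 0))
  have h2 := h ((0, 1), (0, 0))
  have h3 := h ((0, 0), (1, 0))
  have h4 := h ((0, 0), (0, 1))
  simp [lorentzForm_apply] at h1 h2 h3 h4
  subst h1 h2 h3 h4
  rfl

/-- A non-simple positive root is β + q αᵢ with β positive and q > 0. On the chamber its hyperplane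
lies in that of αᵢ, so if it carried a face, the root would be proportional to αᵢ, hence equal to
it. -/
theorem simpleRoots_fundChamber :
    simpleRoots lorentzForm lorentzLattice fundChamber = Set.range simpleVec := by
  refine subset_antisymm ?_ (by rintro _ ⟨i, rfl⟩; exact simpleVec_mem_simpleRoots i)
  rintro α ⟨hα, hnn, hface⟩
  by_contra hns
  have hbase : basePoint ∈ fundChamber :=
    ⟨by rw [basePoint_form_self]; norm_num, fun i => (basePoint_form_simpleVec_pos i).le⟩
  have hpos : 0 < lorentzForm basePoint α :=
    lt_of_le_of_ne (hnn _ hbase) hα.height_ne_zero.symm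
  obtain ⟨i, q, β, hq, hβ, hβ0, hβα, hαβ⟩ := hα.exists_descent hpos hns
  have h1 : ∀ z ∈ {z | z ∈ fundChamber ∧ lorentzForm z α = 0},
      lorentzForm z (simpleVec i) = 0 := by
    rintro z ⟨hz, hzα⟩
    rw [hαβ, map_add, map_smul, smul_eq_mul] at hzα
    have h2 := hβ.form_nonneg hβ0 hz.2
    have h3 := mul_nonneg hq.le (hz.2 i)
    have h4 : q * lorentzForm z (simpleVec i) = 0 := by linarith
    exact (mul_eq_zero.1 h4).resolve_left hq.ne'
  have h2 : ∀ y, lorentzForm y α = 0 → lorentzForm y (simpleVec i) = 0 := by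
    intro y hy
    have := Submodule.span_le (p := LinearMap.ker (LinearMap.flip lorentzForm (simpleVec i))).2
      (fun z hz => by simpa using h1 z hz) (hface y hy)
    simpa using this
  have hα0 := hα.neg.ne
  set c := lorentzForm α (simpleVec i) / lorentzForm α α with hc
  have h3 : simpleVec i - c • α = 0 := by
    apply lorentzForm_nondegenerate
    intro y
    have h4 := h2 (y - (lorentzForm y α / lorentzForm α α) • α) (by
      simp only [map_sub, map_smul, LinearMap.sub_apply, LinearMap.smul_apply, smul_eq_mul]
      field_simp
      ring)
    simp only [map_sub, map_smul, LinearMap.sub_apply, LinearMap.smul_apply, smul_eq_mul] at h4 ⊢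
    rw [hc, ← h4]
    field_simp
  rw [sub_eq_zero] at h3
  obtain ⟨k, a, b, m, n, hk, rfl⟩ := hα.exists_rootCoord
  obtain ⟨t, ht⟩ := hk.dvd_form 0 (-1) 2 (-3)
  have ht' : lorentzForm basePoint (latVec a b m n) = k * t := ht
  have e1 := basePoint_form_simpleVec i
  have e2 := simpleVec_form_self i
  rw [h3, map_smul, smul_eq_mul, ht'] at e1
  rw [h3, map_smul, map_smul, LinearMap.smul_apply, smul_eq_mul, smul_eq_mul, hk.form_self] at e2
  have hk0 : (0 : ℝ) < k := by exact_mod_cast hk.pos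
  have hl0 : (0 : ℝ) < simpleIndex i := by exact_mod_cast simpleIndex_pos i
  have hc0 : c ≠ 0 := by
    rintro h0
    rw [h0, zero_mul] at e1
    exact hl0.ne e1
  -- Comparing heights gives l = c k t and comparing norms gives l = c² k, where l = `simpleIndex
  -- i`.
  have hct : c = t := by
    have : c * k * (t - c) = 0 := by linear_combination e1 + e2 / 2
    have := (mul_eq_zero.1 this).resolve_left (mul_ne_zero hc0 hk0.ne')
    linarith
  rw [hct] at e1
  have e3 : t * (k * t) = simpleIndex i := by exact_mod_cast e1
  have ht0 : 0 < t := by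
    rw [ht'] at hpos
    have := pos_of_mul_pos_right hpos hk0.le
    exact_mod_cast this
  have e4 := simpleIndex_cases i
  -- Now l = t² k, and l is squarefree.
  have ht1 : t = 1 := by
    have e5 : t * t ≤ t * t * k := le_mul_of_one_le_right (by positivity) hk.pos
    have : t ≤ 3 := by nlinarith [show simpleIndex i ≤ 14 by omega]
    interval_cases t <;> omega
  rw [hct, ht1, Int.cast_one, one_smul] at h3
  exact hns ⟨i, h3⟩

theorem isWeylVector_neg_basePoint :
    IsWeylVector lorentzForm lorentzLattice fundChamber (-basePoint) := by
  intro α hα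
  rw [simpleRoots_fundChamber, mem_range_simpleVec_iff hα, map_neg, LinearMap.neg_apply]
  constructor <;> intro h <;> linarith

/-! ### The two cones and the group `Aut(L)⁺` -/

theorem eq_smul_basePoint {y : LSpace}
    (h : lorentzForm basePoint y ^ 2 / 4 ≤ lorentzForm y y) :
    y = (lorentzForm basePoint y / 4) • basePoint := by
  set k := lorentzForm basePoint y with hk
  obtain ⟨z, hz⟩ : ∃ z, z = y - (k / 4) • basePoint := ⟨_, rfl⟩
  have h1 : lorentzForm basePoint z = 0 := by
    rw [hz, map_sub, map_smul, basePoint_form_self, ← hk, smul_eq_mul]; ring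
  have h2 : 0 ≤ lorentzForm z z := by
    rw [hz]
    simp only [map_sub, map_smul, LinearMap.sub_apply, LinearMap.smul_apply, smul_eq_mul,
      basePoint_form_self, lorentzForm_comm y basePoint, ← hk]
    linarith
  suffices z = 0 by rw [hz, sub_eq_zero] at this; exact this
  clear hz
  obtain ⟨⟨p, q⟩, m, n⟩ := z
  simp only [basePoint, latVec, lorentzForm_apply] at h1 h2
  push_cast at h1
  have hn : n = 2 * p + 3 / 2 * m := by linarith
  subst hn
  have h3 : m = 0 := by nlinarith [sq_nonneg (p + m), sq_nonneg m, sq_nonneg q]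
  subst h3
  have h4 : p = 0 := by nlinarith [sq_nonneg p, sq_nonneg q]
  have h5 : q = 0 := by nlinarith [sq_nonneg p, sq_nonneg q]
  subst h4 h5
  simp

theorem form_pos_of_forward {x y : LSpace} (hx : 0 < lorentzForm x x) (hy : 0 < lorentzForm y y)
    (hx' : 0 < lorentzForm basePoint x) (hy' : 0 < lorentzForm basePoint y) :
    0 < lorentzForm x y := by
  rcases lt_or_ge (lorentzForm y y) (lorentzForm basePoint y ^ 2 / 4) with h | h
  · have h1 := cauchySchwarz_basePoint x y h
    set s := lorentzForm basePoint x
    set t := lorentzForm basePoint y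
    have h2 : (s ^ 2 / 4 - lorentzForm x x) * (t ^ 2 / 4 - lorentzForm y y) <
        (s * t / 4) ^ 2 := by
      calc _ ≤ s ^ 2 / 4 * (t ^ 2 / 4 - lorentzForm y y) :=
            mul_le_mul_of_nonneg_right (by linarith) (by linarith)
        _ < s ^ 2 / 4 * (t ^ 2 / 4) := mul_lt_mul_of_pos_left (by linarith) (by positivity)
        _ = _ := by ring
    have h3 := abs_lt_of_sq_lt_sq' (h1.trans_lt h2) (by positivity)
    linarith [h3.1]
  · rw [eq_smul_basePoint h, map_smul, lorentzForm_comm x, smul_eq_mul]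
    positivity

theorem basePoint_form_ne_zero {x : LSpace} (hx : 0 < lorentzForm x x) :
    lorentzForm basePoint x ≠ 0 := fun h =>
  absurd hx (not_lt.2 (lorentzForm_nonpos_of_orthogonal_basePoint h))

theorem form_pos_iff {x y : LSpace} (hx : 0 < lorentzForm x x) (hy : 0 < lorentzForm y y) :
    0 < lorentzForm x y ↔ (0 < lorentzForm basePoint x ↔ 0 < lorentzForm basePoint y) := by
  have hx0 := basePoint_form_ne_zero hx
  have hy0 := basePoint_form_ne_zero hy
  have hx1 : 0 < lorentzForm (-x) (-x) := by simpa using hx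
  have hy1 : 0 < lorentzForm (-y) (-y) := by simpa using hy
  rcases lt_or_gt_of_ne hx0 with h | h <;> rcases lt_or_gt_of_ne hy0 with h' | h'
  · have := form_pos_of_forward hx1 hy1 (by simpa using h) (by simpa using h')
    simp only [map_neg, LinearMap.neg_apply, neg_neg] at this
    simp [this, h.le.not_gt, h'.le.not_gt]
  · have := form_pos_of_forward hx1 hy (by simpa using h) h'
    simp only [map_neg, LinearMap.neg_apply] at this
    simp [h.le.not_gt, h', (show lorentzForm x y ≤ 0 by linarith).not_gt]
  · have := form_pos_of_forward hx hy1 h (by simpa using h')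
    simp only [map_neg] at this
    simp [h, h'.le.not_gt, (show lorentzForm x y ≤ 0 by linarith).not_gt]
  · have := form_pos_of_forward hx hy h h'
    simp [this, h, h']

theorem basePoint_form_self_pos : 0 < lorentzForm basePoint basePoint := by
  rw [basePoint_form_self]; norm_num

/-- By `form_pos_iff` the sign of the height decides the cone, so it is enough to follow one vector.
-/
theorem mem_autPlus_iff {g : LSpace ≃ₗ[ℝ] LSpace} :
    g ∈ autPlus lorentzForm lorentzLattice ↔
      g ∈ latticeIsometries lorentzForm lorentzLattice ∧
        0 < lorentzForm basePoint (g basePoint) := by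
  constructor
  · intro hg
    refine ⟨autPlus_le_latticeIsometries hg, ?_⟩
    have h1 : g basePoint ∈ g '' posCone lorentzForm basePoint :=
      ⟨_, ⟨basePoint_form_self_pos, basePoint_form_self_pos⟩, rfl⟩
    rw [hg.2.2 _ basePoint_form_self_pos] at h1
    exact h1.2
  · rintro ⟨hg, hpos⟩
    refine ⟨hg.1, hg.2, fun x hx => ?_⟩
    have key : ∀ y, 0 < lorentzForm y y → (0 < lorentzForm x (g y) ↔ 0 < lorentzForm x y) := by
      intro y hy
      have hgy : 0 < lorentzForm (g y) (g y) := by rwa [hg.1]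
      have hgb : 0 < lorentzForm (g basePoint) (g basePoint) := by
        rw [hg.1]; exact basePoint_form_self_pos
      have h1 := form_pos_iff hgb hgy
      rw [hg.1] at h1
      rw [form_pos_iff hx hgy, form_pos_iff hx hy]
      tauto
    ext y
    rw [mem_image_iff_inv_apply_mem]
    have hg' := (latticeIsometries lorentzForm lorentzLattice).inv_mem hg
    simp only [posCone, Set.mem_ofPred_eq, hg'.1]
    refine and_congr_right fun hy => ?_
    rw [← key _ (by rwa [hg'.1]), LinearEquiv.apply_inv_apply]

theorem rootReflection_mem_autPlus {α : LSpace} (h : IsRoot lorentzForm lorentzLattice α) :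
    rootReflection h ∈ autPlus lorentzForm lorentzLattice := by
  refine mem_autPlus_iff.2 ⟨rootReflection_mem_latticeIsometries lorentzForm_comm h, ?_⟩
  rw [rootReflection_apply, map_sub, map_smul, basePoint_form_self, smul_eq_mul]
  have : 2 * lorentzForm basePoint α / lorentzForm α α * lorentzForm basePoint α ≤ 0 := by
    rw [div_mul_eq_mul_div]
    exact div_nonpos_of_nonneg_of_nonpos
      (by nlinarith [sq_nonneg (lorentzForm basePoint α)]) h.neg.le
  linarith

theorem reflectionGroup_le_autPlus :
    reflectionGroup lorentzForm lorentzLattice ≤ autPlus lorentzForm lorentzLattice := by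
  rw [reflectionGroup_eq_closure, Subgroup.closure_le]
  rintro _ ⟨α, h, rfl⟩
  exact rootReflection_mem_autPlus h

/-! ### The reflection group is transitive on the chambers in a cone -/

/-- For small ε the vector x - ε `basePoint` stays in the open cone, so its product with v is
positive. This turns a bound on (v, x) into a bound on the height of v. -/
theorem exists_smul_basePoint_le {x : LSpace} (hx : 0 < lorentzForm x x)
    (hx' : 0 < lorentzForm basePoint x) :
    ∃ ε : ℝ, 0 < ε ∧ ∀ v, 0 < lorentzForm v v → 0 < lorentzForm basePoint v →
      ε * lorentzForm basePoint v ≤ lorentzForm v x := by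
  set h := lorentzForm basePoint x with hh
  -- The first upper bound keeps the norm of x - ε `basePoint` positive, the second its height.
  obtain ⟨ε, hε0, hε1, hε2⟩ : ∃ ε : ℝ, 0 < ε ∧ ε < lorentzForm x x / (2 * h) ∧ ε < h / 4 := by
    obtain ⟨ε, h1, h2⟩ := exists_between
      (lt_min (div_pos hx (by positivity : 0 < 2 * h)) (by positivity : 0 < h / 4))
    exact ⟨ε, h1, h2.trans_le (min_le_left _ _), h2.trans_le (min_le_right _ _)⟩
  refine ⟨ε, hε0, fun v hv hv' => ?_⟩
  have h1 : 0 < lorentzForm (x - ε • basePoint) (x - ε • basePoint) := by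
    simp only [map_sub, map_smul, LinearMap.sub_apply, LinearMap.smul_apply, smul_eq_mul,
      basePoint_form_self, lorentzForm_comm x basePoint, ← hh]
    rw [lt_div_iff₀ (by positivity)] at hε1
    nlinarith [sq_nonneg ε]
  have h2 : 0 < lorentzForm basePoint (x - ε • basePoint) := by
    simp only [map_sub, map_smul, smul_eq_mul, basePoint_form_self, ← hh]
    linarith
  have h3 := form_pos_of_forward hv h1 hv' h2
  simp only [map_sub, map_smul, smul_eq_mul, lorentzForm_comm v basePoint] at h3
  linarith

theorem finite_norm_four_le (C : ℝ) :
    {v | v ∈ lorentzLattice ∧ lorentzForm v v = 4 ∧ lorentzForm basePoint v ≤ C ∧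
      0 < lorentzForm basePoint v}.Finite := by
  obtain ⟨M, hM⟩ := exists_nat_ge C
  have hfin : (Set.Icc (-(8 * M : ℤ)) (8 * M)).Finite := Set.finite_Icc _ _
  refine ((((hfin.prod hfin).prod (hfin.prod hfin))).image
    fun p : (ℤ × ℤ) × (ℤ × ℤ) => latVec p.1.1 p.1.2 p.2.1 p.2.2).subset ?_
  rintro v ⟨hv, hv4, hvC, hv0⟩
  obtain ⟨a, b, m, n, rfl⟩ := (mem_lorentzLattice v).1 hv
  rw [basePoint_form_latVec] at hvC hv0
  rw [lorentzForm_latVec_self] at hv4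
  obtain ⟨h, hh⟩ : ∃ h, h = 2 * a + 8 * b + 3 * m - 2 * n := ⟨_, rfl⟩
  rw [← hh] at hvC hv0
  have h0 : 0 < h := by exact_mod_cast hv0
  have h1 : h ≤ M := by
    have : (h : ℝ) ≤ M := hvC.trans hM
    exact_mod_cast this
  have h4 : -4 * (a ^ 2 + a * b + 2 * b ^ 2) - 2 * m * n = 4 := by exact_mod_cast hv4
  -- The sum of squares of `RootCoord.height_ne_zero` again, with v² = 4.
  obtain ⟨X, hX⟩ : ∃ X, X = a + 4 * b + 2 * m := ⟨_, rfl⟩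
  have key : 2 * X ^ 2 + 14 * a ^ 2 + (2 * m - h) ^ 2 = h ^ 2 - 16 := by
    rw [hX, hh]; linear_combination (-4) * h4
  have ha := abs_lt_of_sq_lt_sq' (a := a) (b := h)
    (by linarith [sq_nonneg X, sq_nonneg (2 * m - h), sq_nonneg a]) h0.le
  have hX' := abs_lt_of_sq_lt_sq' (a := X) (b := h)
    (by linarith [sq_nonneg a, sq_nonneg (2 * m - h), sq_nonneg X]) h0.le
  have hm := abs_lt_of_sq_lt_sq' (a := 2 * m - h) (b := h)
    (by linarith [sq_nonneg a, sq_nonneg X]) h0.le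
  refine ⟨((a, b), (m, n)), ?_, rfl⟩
  simp only [Set.mem_prod, Set.mem_Icc]
  omega

/-- Choose w in `W` minimising (w `basePoint`, x); finiteness of lattice vectors of bounded height
provides the minimum. If w⁻¹ x had a negative product with αᵢ, replacing w by w times the reflection
in αᵢ would lower it. Genericity of x excludes product 0. -/
theorem reflectionGroup_exists_interior {x : LSpace} (hx : 0 < lorentzForm x x)
    (hx' : 0 < lorentzForm basePoint x)
    (hgen : ∀ α, IsRoot lorentzForm lorentzLattice α → lorentzForm x α ≠ 0) :
    ∃ w ∈ reflectionGroup lorentzForm lorentzLattice,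
      ∀ i, 0 < lorentzForm (w x) (simpleVec i) := by
  set W := reflectionGroup lorentzForm lorentzLattice
  have hW : ∀ w ∈ W, w ∈ latticeIsometries lorentzForm lorentzLattice ∧
      0 < lorentzForm basePoint (w basePoint) := fun w hw =>
    mem_autPlus_iff.1 (reflectionGroup_le_autPlus hw)
  obtain ⟨ε, hε, hbound⟩ := exists_smul_basePoint_le hx hx'
  let S : Set LSpace := {v | ∃ w ∈ W, v = w basePoint ∧
    lorentzForm v x ≤ lorentzForm basePoint x}
  have hS : S.Finite := by
    refine (finite_norm_four_le (lorentzForm basePoint x / ε)).subset ?_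
    rintro _ ⟨w, hw, rfl, hle⟩
    obtain ⟨h1, h2⟩ := hW w hw
    have h4 : lorentzForm (w basePoint) (w basePoint) = 4 := by rw [h1.1, basePoint_form_self]
    refine ⟨(h1.2 _).2 (latVec_mem ..), h4, ?_, h2⟩
    rw [le_div_iff₀ hε, mul_comm]
    exact (hbound _ (by rw [h4]; norm_num) h2).trans hle
  obtain ⟨v, ⟨w, hw, rfl, hle⟩, hmin⟩ := Set.exists_min_image S (fun v => lorentzForm v x) hS
    ⟨basePoint, 1, W.one_mem, rfl, le_rfl⟩
  refine ⟨w⁻¹, W.inv_mem hw, fun i => ?_⟩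
  have hwi := (hW w hw).1
  have hi := simpleReflection_mem_latticeIsometries i
  refine lt_of_le_of_ne ?_ ?_
  · by_contra! hneg
    have h1 : lorentzForm ((w * simpleReflection i) basePoint) x =
        lorentzForm (w basePoint) x + lorentzForm (w⁻¹ x) (simpleVec i) := by
      have h2 := basePoint_form_simpleReflection i (w⁻¹ x)
      rw [← hi.1, simpleReflection, rootReflection_rootReflection, ← hwi.1,
        LinearEquiv.apply_inv_apply, ← hwi.1 basePoint, LinearEquiv.apply_inv_apply] at h2
      exact h2
    have h3 := hmin _ ⟨w * simpleReflection i,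
      W.mul_mem hw (rootReflection_mem_reflectionGroup _), rfl, by linarith⟩
    linarith
  · rw [form_inv_apply hwi]
    exact (hgen _ ((simpleVec_isRoot i).map hwi)).symm

/-- Multiplication by -1 exchanges the two cones. -/
theorem latticeIsometries_exists_interior {x : LSpace} (hx : 0 < lorentzForm x x)
    (hgen : ∀ α, IsRoot lorentzForm lorentzLattice α → lorentzForm x α ≠ 0) :
    ∃ g ∈ latticeIsometries lorentzForm lorentzLattice,
      ∀ i, 0 < lorentzForm (g x) (simpleVec i) := by
  have hneg : (LinearEquiv.neg ℝ : LSpace ≃ₗ[ℝ] LSpace) ∈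
      latticeIsometries lorentzForm lorentzLattice := ⟨fun x y => by simp, fun x => by simp⟩
  rcases lt_or_gt_of_ne (basePoint_form_ne_zero hx) with h | h
  · obtain ⟨w, hw, hw'⟩ := reflectionGroup_exists_interior (x := -x) (by simpa using hx)
      (by simpa using h) (fun α hα => by simpa using hgen α hα)
    exact ⟨w * LinearEquiv.neg ℝ, (latticeIsometries _ _).mul_mem
      (autPlus_le_latticeIsometries (reflectionGroup_le_autPlus hw)) hneg, hw'⟩
  · obtain ⟨w, hw, hw'⟩ := reflectionGroup_exists_interior hx h hgen
    exact ⟨w, autPlus_le_latticeIsometries (reflectionGroup_le_autPlus hw), hw'⟩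

theorem IsWeylChamber.exists_eq_image {D : Set LSpace}
    (hD : IsWeylChamber lorentzForm lorentzLattice D) :
    ∃ g ∈ latticeIsometries lorentzForm lorentzLattice, D = g '' fundChamber := by
  obtain ⟨x, hx, hgen, rfl⟩ := hD
  obtain ⟨g, hg, hg'⟩ := latticeIsometries_exists_interior hx hgen
  have hi := (latticeIsometries _ _).inv_mem hg
  refine ⟨g⁻¹, hi, ?_⟩
  rw [← weylChamber_eq_fundChamber hg', ← weylChamber_map hi, LinearEquiv.inv_apply_apply]

/-! ### The symmetries of the fundamental chamber -/

/-- The nontrivial symmetry of the fundamental chamber. -/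
noncomputable def chamberSymmetry : LSpace ≃ₗ[ℝ] LSpace where
  toFun x := ((-x.1.1 - 2 * x.2.1, -x.1.2), (x.2.1, x.2.2 - 4 * x.1.1 - 4 * x.2.1))
  invFun x := ((-x.1.1 - 2 * x.2.1, -x.1.2), (x.2.1, x.2.2 - 4 * x.1.1 - 4 * x.2.1))
  map_add' x y := by ext <;> simp <;> ring
  map_smul' c x := by ext <;> simp <;> ring
  left_inv x := by ext <;> simp; ring
  right_inv x := by ext <;> simp; ring

theorem chamberSymmetry_apply (x : LSpace) : chamberSymmetry x =
    ((-x.1.1 - 2 * x.2.1, -x.1.2), (x.2.1, x.2.2 - 4 * x.1.1 - 4 * x.2.1)) := rfl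

theorem chamberSymmetry_mul_self : chamberSymmetry * chamberSymmetry = 1 := by
  ext x : 1
  exact chamberSymmetry.left_inv x

theorem chamberSymmetry_latVec (a b m n : ℤ) :
    chamberSymmetry (latVec a b m n) =
      latVec (-a) (-b - m) m (n - 2 * a - 8 * b - 4 * m) := by
  rw [chamberSymmetry_apply]
  ext <;> simp [latVec] <;> ring

theorem chamberSymmetry_mem_autPlus :
    chamberSymmetry ∈ autPlus lorentzForm lorentzLattice := by
  have hL : ∀ x ∈ lorentzLattice, chamberSymmetry x ∈ lorentzLattice := fun x hx => by
    obtain ⟨a, b, m, n, rfl⟩ := (mem_lorentzLattice x).1 hx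
    rw [chamberSymmetry_latVec]; exact latVec_mem ..
  refine mem_autPlus_iff.2 ⟨⟨fun x y => ?_, fun x => ⟨fun h => ?_, hL x⟩⟩, ?_⟩
  · simp only [chamberSymmetry_apply, lorentzForm_apply]; ring
  · have := hL _ h
    rwa [← LinearEquiv.mul_apply, chamberSymmetry_mul_self] at this
  · rw [basePoint, chamberSymmetry_latVec, lorentzForm_latVec]; norm_num

/-- The vectors `latVec a b m n` with `b` even and `m`, `n` odd. -/
def parityClass : Set LSpace :=
  {x | ∃ a b m n : ℤ, x = latVec a b m n ∧ Even b ∧ Odd m ∧ Odd n}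

/-- The reflection adds s α. If k is even, then m and n are even and the norm forces b to be even.
If k is odd, then m and n are odd, so the product with a vector of the class is even and s is even.
-/
theorem rootReflection_mem_parityClass {α : LSpace} (h : IsRoot lorentzForm lorentzLattice α)
    {x : LSpace} (hx : x ∈ parityClass) : rootReflection h x ∈ parityClass := by
  obtain ⟨a', b', m', n', rfl, hb', hm', hn'⟩ := hx
  obtain ⟨k, a, b, m, n, hk, rfl⟩ := h.exists_rootCoord
  obtain ⟨s, hs⟩ := hk.dvd_form a' b' m' n'
  have hk0 : (k : ℝ) ≠ 0 := by exact_mod_cast hk.pos.ne'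
  have h1 : rootReflection h (latVec a' b' m' n') =
      latVec (a' + s * a) (b' + s * b) (m' + s * m) (n' + s * n) := by
    rw [rootReflection_apply, hs, hk.form_self, ← latVec_add, ← latVec_smul, sub_eq_add_neg,
      ← neg_smul]
    congr 2; field_simp
  rw [lorentzForm_latVec] at hs
  have hs' : -2 * (2 * a' * a + a' * b + b' * a + 4 * b' * b) - (m' * n + n' * m) = k * s := by
    exact_mod_cast hs
  have h2 : Even (s * b) ∧ Even (s * m) ∧ Even (s * n) := by
    have hq := hk.norm
    have hkm := hk.dvd_m
    have hkn := hk.dvd_n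
    by_cases hke : Even k
    · obtain ⟨p, rfl⟩ := (even_iff_two_dvd.1 hke).trans hkm
      obtain ⟨r, rfl⟩ := (even_iff_two_dvd.1 hke).trans hkn
      have h3 : Odd (a ^ 2 + a * b + 2 * b ^ 2) := by
        have := hk.cases
        have h5 : a ^ 2 + a * b + 2 * b ^ 2 + 2 * (p * r) = 1 ∨
            a ^ 2 + a * b + 2 * b ^ 2 + 2 * (p * r) = 7 := by
          rcases this with rfl | rfl | rfl | rfl
          · exact absurd hke (by decide)
          · left; linarith
          · exact absurd hke (by decide)
          · right; linarith
        rw [Int.odd_iff]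
        omega
      have h4 : Even b := by
        by_contra hb
        rw [Int.not_even_iff_odd] at hb
        have h6 : Even (a ^ 2 + a * b) := by
          rw [show a ^ 2 + a * b = a * (a + b) by ring, Int.even_mul]
          rcases Int.even_or_odd a with ha | ha
          · exact Or.inl ha
          · exact Or.inr (ha.add_odd hb)
        rw [Int.odd_iff] at h3
        rw [Int.even_iff] at h6
        omega
      exact ⟨h4.mul_left s, (even_two_mul p).mul_left s, (even_two_mul r).mul_left s⟩
    · have hmn : Odd (m * n) := by
        rw [Int.not_even_iff_odd] at hke
        rw [← hq, Int.odd_iff] at hke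
        rw [Int.odd_iff]
        omega
      obtain ⟨hm, hn⟩ := Int.odd_mul.1 hmn
      have h3 : Even (k * s) := by
        rw [← hs']
        exact (Even.mul_right (by decide) _).sub ((hm'.mul hn).add_odd (hn'.mul hm))
      have h4 : Even s := (Int.even_mul.1 h3).resolve_left hke
      exact ⟨h4.mul_right b, h4.mul_right m, h4.mul_right n⟩
  exact ⟨_, _, _, _, h1, hb'.add h2.1, hm'.add_even h2.2.1, hn'.add_even h2.2.2⟩

theorem reflectionGroup_mem_parityClass {w : LSpace ≃ₗ[ℝ] LSpace}
    (hw : w ∈ reflectionGroup lorentzForm lorentzLattice) (x : LSpace) :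
    w x ∈ parityClass ↔ x ∈ parityClass := by
  rw [reflectionGroup_eq_closure] at hw
  induction hw using Subgroup.closure_induction generalizing x with
  | mem g hg =>
    obtain ⟨α, h, rfl⟩ := hg
    refine ⟨fun hx => ?_, rootReflection_mem_parityClass h⟩
    simpa only [rootReflection_rootReflection] using rootReflection_mem_parityClass h hx
  | one => rfl
  | mul g g' _ _ ih ih' => rw [LinearEquiv.mul_apply, ih, ih']
  | inv g _ ih => rw [← ih, LinearEquiv.apply_inv_apply]

theorem chamberSymmetry_notMem_reflectionGroup :
    chamberSymmetry ∉ reflectionGroup lorentzForm lorentzLattice := by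
  intro h
  -- The symmetry sends b to -b - m, which is odd on the class.
  have h1 := (reflectionGroup_mem_parityClass h (latVec 0 0 1 1)).2
    ⟨0, 0, 1, 1, rfl, by decide, by decide, by decide⟩
  rw [chamberSymmetry_latVec] at h1
  obtain ⟨a, b, m, n, h2, hb, -, -⟩ := h1
  obtain ⟨-, rfl, -, -⟩ := latVec_inj.1 h2
  exact absurd hb (by decide)

/-! ### Automorphisms of the chamber, arithmeticity and index. -/

theorem linearEquiv_ext_of_simpleVec {f g : LSpace ≃ₗ[ℝ] LSpace}
    (h0 : f (simpleVec 0) = g (simpleVec 0)) (h1 : f (simpleVec 1) = g (simpleVec 1))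
    (h2 : f (simpleVec 2) = g (simpleVec 2)) (h3 : f (simpleVec 3) = g (simpleVec 3)) :
    f = g := by
  ext x : 1
  obtain ⟨c0, c1, c2, c3, hx⟩ : ∃ c0 c1 c2 c3 : ℝ, x = c0 • simpleVec 0 + c1 • simpleVec 1 +
      c2 • simpleVec 2 + c3 • simpleVec 3 := by
    -- The first four simple roots form a real basis; these are the coordinates of x in it.
    refine ⟨-((x.1.1 - x.1.2) / 2),
      2 * x.1.2 + (4 * ((x.1.1 - x.1.2) / 2) + x.2.1 - x.2.2) / 2,
      x.2.1 + (x.1.1 - x.1.2) / 2, (4 * ((x.1.1 - x.1.2) / 2) + x.2.1 - x.2.2) / 2, ?_⟩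
    ext <;> simp [simpleVec, latVec] <;> ring
  rw [hx]
  simp only [map_add, map_smul, h0, h1, h2, h3]

/-- The isometry permutes the simple roots and preserves their Gram matrix. Norms restrict it to the
pairs {0, 2} and {1, 3}, and the double line from 0 to 1 forces both pairs to be swapped or both
fixed. -/
theorem eq_one_or_eq_chamberSymmetry {h : LSpace ≃ₗ[ℝ] LSpace}
    (hh : h ∈ latticeIsometries lorentzForm lorentzLattice)
    (hD : h '' fundChamber = fundChamber) : h = 1 ∨ h = chamberSymmetry := by
  have hS : h '' Set.range simpleVec = Set.range simpleVec := by
    rw [← simpleRoots_fundChamber, ← simpleRoots_map hh, hD]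
  have hp : ∀ i, ∃ j, simpleVec j = h (simpleVec i) := fun i =>
    hS.subset ⟨_, ⟨i, rfl⟩, rfl⟩
  choose p hp using hp
  have hG : ∀ i j, simpleGram (p i) (p j) = simpleGram i j := fun i j => by
    have := hh.1 (simpleVec i) (simpleVec j)
    rw [← hp, ← hp, simpleVec_form_simpleVec, simpleVec_form_simpleVec] at this
    exact_mod_cast this
  have e1 : ∀ j, simpleGram j j = -2 → j = 0 ∨ j = 2 := by decide
  have e2 : ∀ j, simpleGram j j = -4 → j = 1 ∨ j = 3 := by decide
  have p0 := e1 _ (hG 0 0)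
  have p1 := e2 _ (hG 1 1)
  have p2 := e1 _ (hG 2 2)
  have p3 := e2 _ (hG 3 3)
  have g01 := hG 0 1
  have g02 := hG 0 2
  have g13 := hG 1 3
  have key : (p 0 = 0 ∧ p 1 = 1 ∧ p 2 = 2 ∧ p 3 = 3) ∨
      (p 0 = 2 ∧ p 1 = 3 ∧ p 2 = 0 ∧ p 3 = 1) := by
    generalize p 0 = q0, p 1 = q1, p 2 = q2, p 3 = q3 at *
    rcases p0 with rfl | rfl <;> rcases p1 with rfl | rfl <;> rcases p2 with rfl | rfl <;>
      rcases p3 with rfl | rfl <;> revert g01 g02 g13 <;> decide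
  rcases key with ⟨q0, q1, q2, q3⟩ | ⟨q0, q1, q2, q3⟩
  · left
    apply linearEquiv_ext_of_simpleVec
    · rw [← hp, q0]; rfl
    · rw [← hp, q1]; rfl
    · rw [← hp, q2]; rfl
    · rw [← hp, q3]; rfl
  · right
    apply linearEquiv_ext_of_simpleVec
    · rw [← hp, q0]; simp [simpleVec, chamberSymmetry_latVec]
    · rw [← hp, q1]; simp [simpleVec, chamberSymmetry_latVec]
    · rw [← hp, q2]; simp [simpleVec, chamberSymmetry_latVec]
    · rw [← hp, q3]; simp [simpleVec, chamberSymmetry_latVec]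

theorem isArithmeticReflectionGroup_lorentzLattice :
    IsArithmeticReflectionGroup lorentzForm lorentzLattice := by
  intro D hD
  obtain ⟨g, hg, rfl⟩ := hD.exists_eq_image
  refine (Set.toFinite {1, g * chamberSymmetry * g⁻¹}).subset ?_
  rintro f ⟨hf, hfD⟩
  have hf' := autPlus_le_latticeIsometries hf
  have h1 : (g⁻¹ * f * g) '' fundChamber = fundChamber := by
    have : (⇑(g⁻¹ * f * g) : LSpace → LSpace) = ⇑g⁻¹ ∘ ⇑f ∘ ⇑g := rfl
    rw [this, Set.image_comp, Set.image_comp, hfD]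
    ext y
    rw [mem_image_iff_inv_apply_mem, inv_inv, g.injective.mem_set_image]
  have hmem : g⁻¹ * f * g ∈ latticeIsometries lorentzForm lorentzLattice :=
    Subgroup.mul_mem _ (Subgroup.mul_mem _ (Subgroup.inv_mem _ hg) hf') hg
  rcases eq_one_or_eq_chamberSymmetry hmem h1 with h2 | h2
  · left
    have : f = g * (g⁻¹ * f * g) * g⁻¹ := by group
    rw [this, h2]; group
  · right
    rw [Set.mem_singleton_iff, ← h2]; group

/-- For g in `Aut(L)⁺` some w in `W` brings g `basePoint` back into the fundamental chamber. Then w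
g preserves that chamber, so g lies in `W` or in its coset of `chamberSymmetry`, and these two
cosets differ. -/
theorem relIndex_reflectionGroup_autPlus :
    (reflectionGroup lorentzForm lorentzLattice).relIndex
      (autPlus lorentzForm lorentzLattice) = 2 := by
  rw [Subgroup.relIndex_eq_two_iff]
  refine ⟨chamberSymmetry, chamberSymmetry_mem_autPlus, fun g hg => ?_⟩
  obtain ⟨hg1, hg2⟩ := mem_autPlus_iff.1 hg
  obtain ⟨w, hw, hwi⟩ := reflectionGroup_exists_interior (x := g basePoint)
    (by rw [hg1.1]; exact basePoint_form_self_pos) hg2 (fun α hα => by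
      have := (hα.map ((latticeIsometries _ _).inv_mem hg1)).height_ne_zero
      rwa [← hg1.1, LinearEquiv.apply_inv_apply] at this)
  have hwg : w * g ∈ latticeIsometries lorentzForm lorentzLattice :=
    Subgroup.mul_mem _ (autPlus_le_latticeIsometries (reflectionGroup_le_autPlus hw)) hg1
  have hD : (w * g) '' fundChamber = fundChamber := by
    conv_lhs => rw [← weylChamber_eq_fundChamber basePoint_form_simpleVec_pos]
    rw [← weylChamber_map hwg]
    exact weylChamber_eq_fundChamber hwi
  have hns := chamberSymmetry_notMem_reflectionGroup
  rcases eq_one_or_eq_chamberSymmetry hwg hD with h | h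
  · have hgw : g = w⁻¹ := eq_inv_of_mul_eq_one_right h
    have hgW : g ∈ reflectionGroup lorentzForm lorentzLattice := hgw ▸ Subgroup.inv_mem _ hw
    exact Or.inr ⟨hgW, fun h' => hns ((Subgroup.mul_mem_cancel_left _ hgW).1 h')⟩
  · have hgw : g = w⁻¹ * chamberSymmetry := by rw [← h]; group
    refine Or.inl ⟨?_, fun h' => hns ?_⟩
    · rw [hgw, mul_assoc, chamberSymmetry_mul_self, mul_one]
      exact Subgroup.inv_mem _ hw
    · rw [← h]; exact Subgroup.mul_mem _ hw h'

/-! ### The Dynkin diagram -/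

theorem hasDynkinDiagram_fundChamber :
    HasDynkinDiagram lorentzForm (Set.range simpleVec) dynkinDiagram := by
  refine ⟨simpleVec, simpleVec_injective, rfl, fun i j hij => ?_⟩
  unfold IsBond
  rw [simpleVec_form_simpleVec, simpleVec_form_simpleVec, simpleVec_form_simpleVec]
  fin_cases i <;> fin_cases j <;>
    first
    | exact absurd rfl hij
    | (simp [dynkinDiagram, simpleGram] <;> norm_num)

theorem ncard_simpleVec_norm {x : ℝ} (hx : x ∈ ({-2, -4, -14, -28} : Set ℝ)) :
    {α ∈ Set.range simpleVec | lorentzForm α α = x}.ncard = 2 := by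
  obtain ⟨k, hk, hk'⟩ : ∃ k : ℤ, x = -2 * k ∧
      (Finset.univ.filter fun i => simpleIndex i = k).card = 2 := by
    rcases hx with rfl | rfl | rfl | rfl
    · exact ⟨1, by norm_num, by decide⟩
    · exact ⟨2, by norm_num, by decide⟩
    · exact ⟨7, by norm_num, by decide⟩
    · exact ⟨14, by norm_num, by decide⟩
  have h1 : {α ∈ Set.range simpleVec | lorentzForm α α = x} =
      simpleVec '' (Finset.univ.filter fun i => simpleIndex i = k : Finset (Fin 8)) := by
    ext α
    constructor
    · rintro ⟨⟨i, rfl⟩, hi⟩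
      rw [simpleVec_form_self, hk] at hi
      have : (simpleIndex i : ℝ) = k := by linarith
      exact ⟨i, by simpa using this, rfl⟩
    · rintro ⟨i, hi, rfl⟩
      have : simpleIndex i = k := by simpa using hi
      exact ⟨⟨i, rfl⟩, by rw [simpleVec_form_self, hk, this]⟩
  rw [h1, Set.ncard_image_of_injective _ simpleVec_injective, Set.ncard_coe_finset, hk']

theorem mainTheorem11 :
    IsEvenLorentzianLattice lorentzForm lorentzLattice ∧
    HasLevel lorentzForm lorentzLattice 14 ∧
    {n : ℝ | ∃ α, IsRoot lorentzForm lorentzLattice α ∧ lorentzForm α α = n} =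
      {-2, -4, -14, -28} ∧
    (∀ D, IsWeylChamber lorentzForm lorentzLattice D →
      (simpleRoots lorentzForm lorentzLattice D).ncard = 8 ∧
      (∀ n ∈ ({-2, -4, -14, -28} : Set ℝ),
        {α ∈ simpleRoots lorentzForm lorentzLattice D | lorentzForm α α = n}.ncard = 2) ∧
      (∃ ρ ∈ lorentzLattice, lorentzForm ρ ρ = 4 ∧
        IsWeylVector lorentzForm lorentzLattice D ρ) ∧
      HasDynkinDiagram lorentzForm (simpleRoots lorentzForm lorentzLattice D) dynkinDiagram) ∧
    (∃ D, IsWeylChamber lorentzForm lorentzLattice D ∧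
      IsWeylVector lorentzForm lorentzLattice D ((2, 0), (-2, 3))) ∧
    IsArithmeticReflectionGroup lorentzForm lorentzLattice ∧
    reflectionGroup lorentzForm lorentzLattice ≤ autPlus lorentzForm lorentzLattice ∧
    (reflectionGroup lorentzForm lorentzLattice).relIndex (autPlus lorentzForm lorentzLattice) = 2 := by
  refine ⟨isEvenLorentzianLattice_lorentzLattice, hasLevel_lorentzLattice, root_norms, ?_,
    ⟨fundChamber, isWeylChamber_fundChamber, ?_⟩, isArithmeticReflectionGroup_lorentzLattice,
    reflectionGroup_le_autPlus, relIndex_reflectionGroup_autPlus⟩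
  · intro D hD
    obtain ⟨g, hg, rfl⟩ := hD.exists_eq_image
    rw [simpleRoots_map hg, simpleRoots_fundChamber]
    refine ⟨?_, fun x hx => ?_, ⟨g (-basePoint), ?_, ?_, isWeylVector_neg_basePoint.map hg⟩,
      hasDynkinDiagram_fundChamber.map hg.1⟩
    · rw [Set.ncard_image_of_injective _ g.injective, ← Set.image_univ,
        Set.ncard_image_of_injective _ simpleVec_injective, Set.ncard_univ, Nat.card_fin]
    · rw [← ncard_simpleVec_norm hx, ← Set.ncard_image_of_injective
        {α ∈ Set.range simpleVec | lorentzForm α α = x} g.injective]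
      congr 1
      ext α
      constructor
      · rintro ⟨⟨β, hβ, rfl⟩, h⟩
        exact ⟨β, ⟨hβ, by rwa [hg.1] at h⟩, rfl⟩
      · rintro ⟨β, ⟨hβ, h⟩, rfl⟩
        exact ⟨⟨β, hβ, rfl⟩, by rwa [hg.1]⟩
    · exact (hg.2 _).2 (lorentzLattice.neg_mem (latVec_mem ..))
    · rw [hg.1, map_neg, map_neg, LinearMap.neg_apply, neg_neg, basePoint_form_self]
  · convert isWeylVector_neg_basePoint using 1
    ext <;> simp [basePoint, latVec]
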